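/- **Setting.** Let $d\ge 1$, $m\ge 0$, let $g:\mathbb R^d\times\mathbb R^m\to\mathbb R$ be measurable, and let $Y=g(X,\epsilon)$, where the input $X\in\mathbb R^d$ and the random seed $\epsilon\in\mathbb R^m$ are independent random vectors. Let $(X_i,Y_i)_{i\ge1}$ be an i.i.d. sample of $(X,Y)$. Put $Y^x=g(x,\epsilon)$, and for a ball $B$ let $Y^B$ have the law of $Y$ given $X\in B$. $F_Z$ denotes the distribution function of $Z$ and $B(x,r)$ the closed Euclidean ball. Fix a level $\alpha\in[1/2,1)$ and let $\theta^*(x)=\inf\{t: F_{Y^x}(t)\ge\alpha\}$. For $0<\gamma\le\beta<1$ let $\gamma_n=n^{-\gamma}$, $k_n=\lfloor n^\beta\rfloor$, and $$\theta_{n+1}(x)=\theta_n(x)-\gamma_{n+1}\bigl(\mathbf 1_{Y_{n+1}\le\theta_n(x)}-\alpha\bigr)\mathbf 1_{\|X_{n+1}-x\|\le\|X-x\|_{(k_{n+1},n)}},\qquad n\ge0,$$ where $\|X-x\|_{(k,n)}$ is the $k$-th smallest of $\|X_1-x\|,\dots,\|X_n-x\|$ (and $+\infty$ if $k>n$), and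 $\theta_0(x)$ is a constant. **Assumptions.** - A1: for every $x\in\operatorname{supp}X$ there is $M(x)$ such that $|F_{Y^B}(t)-F_{Y^x}(t)|\le M(x)\,r$ for all $t\in\mathbb R$ and all balls $B$ with centre $x$ and radius $r>0$. - A2: $X$ has a density which is at least $C_{\rm input}>0$ on $\operatorname{supp}X$. - A3: $g$ takes its values in $[L_Y,U_Y]$. - A4: for every $x\in\operatorname{supp}X$, the support of the law of $g(x,\epsilon)$ is an interval, and this law has a density which is at least $C_g(x)>0$ on its support. Let $x\in\operatorname{supp}X$ and $\theta_0(x)\in[L_Y-(1-\alpha),U_Y+\alpha]$, and let $\rho>0$ be such that $\operatorname{vol}(\operatorname{supp}X\cap B(x,r))\ge\rho\operatorname{vol}(B(x,r))$ for all $r>0$ with $\operatorname{supp}X\not\subseteq B(x,r)$. **Theorem.** For all $\gamma,\beta,\varepsilon$ with $0<\gamma\le\beta<1$ and $1-\beta<\varepsilon<1$, and all integers $n\ge N_0+1$, where $N_0=\lceil 2^{1/(\varepsilon-(1-\beta))}\rceil$, the random variable $(\theta_n(x)-\theta^*(x))^2$ is integrable and $a_n(x)=\mathbb E[(\theta_n(x)-\theta^*(x))^2]$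 satisfies $$a_n(x)\le e^{-2C_2(\kappa_n-\kappa_{N_0})}C_1+\sum_{k=N_0+1}^n e^{-2C_2(\kappa_n-\kappa_k)}d_k+C_1e^{-3n^{1-\varepsilon}/8},$$ where $\kappa_j=\sum_{i=1}^j i^{-\varepsilon-\gamma}$, $$d_k=C_1e^{-3k^{1-\varepsilon}/8}+2\sqrt{C_1}\,M(x)\,C_3\,\gamma_k\Bigl(\frac{k_k}{k}\Bigr)^{1+1/d}+\gamma_k^2\,\frac{k_k}{k},$$ $$\sqrt{C_1}=U_Y-L_Y+\alpha,\qquad C_2=\min\Bigl(C_g(x),\frac{1-\alpha}{U_Y+\alpha-L_Y}\Bigr),$$ $$C_3=\Bigl(\frac{4}{\rho\,C_{\rm input}\,C_4}\Bigr)^{1/d}\Bigl(1+\frac{8}{3d}\Bigr),\qquad C_4=\frac{\pi^{d/2}}{\Gamma(d/2+1)}.$$ -/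

import Mathlib

open MeasureTheory ProbabilityTheory Set
open scoped ENNReal

noncomputable section

/-! ### The stochastic code `Y = g(X, ε)` -/

/-- The law of the pair `(X, Y) = (X, g(X, ε))`, where `X` has law `μ`, the random seed `ε` has
law `ν`, and `X` and `ε` are independent. -/
def jointLaw {d m : ℕ} (g : EuclideanSpace ℝ (Fin d) → EuclideanSpace ℝ (Fin m) → ℝ)
    (μ : Measure (EuclideanSpace ℝ (Fin d))) (ν : Measure (EuclideanSpace ℝ (Fin m))) :
    Measure (EuclideanSpace ℝ (Fin d) × ℝ) :=
  (μ.prod ν).map (fun p => (p.1, g p.1 p.2))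

/-- The law of `Y^x = g(x, ε)` for a fixed input `x`. -/
def codeLaw {d m : ℕ} (g : EuclideanSpace ℝ (Fin d) → EuclideanSpace ℝ (Fin m) → ℝ)
    (ν : Measure (EuclideanSpace ℝ (Fin m))) (x : EuclideanSpace ℝ (Fin d)) : Measure ℝ :=
  ν.map (g x)

/-- The law of `Y^B`, that is, the conditional law of `Y` given `X ∈ B`. -/
def localLaw {d m : ℕ} (g : EuclideanSpace ℝ (Fin d) → EuclideanSpace ℝ (Fin m) → ℝ)
    (μ : Measure (EuclideanSpace ℝ (Fin d))) (ν : Measure (EuclideanSpace ℝ (Fin m)))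
    (B : Set (EuclideanSpace ℝ (Fin d))) : Measure ℝ :=
  (cond (jointLaw g μ ν) (Prod.fst ⁻¹' B)).map Prod.snd

/-- The quantile of level `α`: `F⁻¹(α) = inf {t | F(t) ≥ α}`, with `F` the cumulative distribution
function of the law. -/
def quantile (law : Measure ℝ) (α : ℝ) : ℝ :=
  sInf {t : ℝ | α ≤ cdf law t}

/-! ### The four assumptions -/

/-- A1: for every `x` in the support of `X`, all balls `B` centred at `x` (of radius `r > 0`) and all
`t`, `|F_{Y^B}(t) - F_{Y^x}(t)| ≤ M(x) r`. -/
def AssumptionA1 {d m : ℕ} (g : EuclideanSpace ℝ (Fin d) → EuclideanSpace ℝ (Fin m) → ℝ)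
    (μ : Measure (EuclideanSpace ℝ (Fin d))) (ν : Measure (EuclideanSpace ℝ (Fin m)))
    (M : EuclideanSpace ℝ (Fin d) → ℝ) : Prop :=
  ∀ x ∈ μ.support, ∀ r : ℝ, 0 < r → ∀ t : ℝ,
    |cdf (localLaw g μ ν (Metric.closedBall x r)) t - cdf (codeLaw g ν x) t| ≤ M x * r

/-- A2: the law of `X` has a density with respect to Lebesgue measure which is bounded below by
`Cinput > 0` on the support of `X`. -/
def AssumptionA2 {d : ℕ} (μ : Measure (EuclideanSpace ℝ (Fin d))) (Cinput : ℝ) : Prop :=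
  0 < Cinput ∧ ∃ f : EuclideanSpace ℝ (Fin d) → ℝ≥0∞, Measurable f ∧
    μ = volume.withDensity f ∧ ∀ z ∈ μ.support, ENNReal.ofReal Cinput ≤ f z

/-- A3: `g` takes its values in the compact interval `[LY, UY]`. -/
def AssumptionA3 {d m : ℕ} (g : EuclideanSpace ℝ (Fin d) → EuclideanSpace ℝ (Fin m) → ℝ)
    (LY UY : ℝ) : Prop :=
  ∀ x e, g x e ∈ Icc LY UY

/-- A4: for every input `x` in the support of `X`, the support of the law of `g(x, ε)` is an
interval, and this law has a density which is bounded below by `Cg(x) > 0` on its support. -/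
def AssumptionA4 {d m : ℕ} (g : EuclideanSpace ℝ (Fin d) → EuclideanSpace ℝ (Fin m) → ℝ)
    (μ : Measure (EuclideanSpace ℝ (Fin d))) (ν : Measure (EuclideanSpace ℝ (Fin m)))
    (Cg : EuclideanSpace ℝ (Fin d) → ℝ) : Prop :=
  ∀ x ∈ μ.support, 0 < Cg x ∧ (codeLaw g ν x).support.OrdConnected ∧
    ∃ f : ℝ → ℝ≥0∞, Measurable f ∧ codeLaw g ν x = volume.withDensity f ∧
      ∀ y ∈ (codeLaw g ν x).support, ENNReal.ofReal (Cg x) ≤ f y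

/-- The set `S` fills at least the fraction `ρ` of every ball centred at `x` that does not already
contain `S`. -/
def FillsBalls {d : ℕ} (S : Set (EuclideanSpace ℝ (Fin d))) (x : EuclideanSpace ℝ (Fin d))
    (ρ : ℝ) : Prop :=
  ∀ r : ℝ, 0 < r → ¬ S ⊆ Metric.closedBall x r →
    ENNReal.ofReal ρ * volume (Metric.closedBall x r) ≤ volume (S ∩ Metric.closedBall x r)

/-! ### The algorithm -/

/-- The number of neighbours `k_n = ⌊n ^ β⌋`. -/
def numNeighbours (β : ℝ) (n : ℕ) : ℕ := ⌊(n : ℝ) ^ β⌋₊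

/-- The step size `γ_n = n ^ (-γ)`. -/
def stepSize (γ : ℝ) (n : ℕ) : ℝ := (n : ℝ) ^ (-γ)

/-- The order statistic `‖X - x‖_{(k, n)}`: the `k`-th smallest of the distances to `x` of the first
`n` points `u 0, …, u (n - 1)` (it is `∞` if there are fewer than `k` points). -/
def kthDistance {d : ℕ} (u : ℕ → EuclideanSpace ℝ (Fin d)) (x : EuclideanSpace ℝ (Fin d))
    (k n : ℕ) : ℝ≥0∞ :=
  sInf {r : ℝ≥0∞ | k ≤ ((Finset.range n).filter (fun i => edist (u i) x ≤ r)).card}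

open Classical in
/-- The sequence `θ_n(x)` of the algorithm, run on the inputs `u` and the outputs `y`. The
observations are numbered from `0`: the `(n + 1)`-st observation `(X_{n+1}, Y_{n+1})` is
`(u n, y n)`. -/
def theta {d : ℕ} (α γ β θ₀ : ℝ) (x : EuclideanSpace ℝ (Fin d))
    (u : ℕ → EuclideanSpace ℝ (Fin d)) (y : ℕ → ℝ) : ℕ → ℝ
  | 0 => θ₀
  | n + 1 => theta α γ β θ₀ x u y n -
      stepSize γ (n + 1) * ((if y n ≤ theta α γ β θ₀ x u y n then 1 else 0) - α) *
        (if edist (u n) x ≤ kthDistance u x (numNeighbours β (n + 1)) n then 1 else 0)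

/-! ### The constants and the remainders -/

/-- `√C₁ = U_Y + α - L_Y`. -/
def sqrtC1 (LY UY α : ℝ) : ℝ := UY + α - LY

/-- `C₁`. -/
def C1 (LY UY α : ℝ) : ℝ := sqrtC1 LY UY α ^ 2

/-- `C₂(x, α) = min (C_g(x), (1 - α) / (U_Y + α - L_Y))`; here `c` is `C_g(x)`. -/
def C2 (c LY UY α : ℝ) : ℝ := min c ((1 - α) / (UY + α - LY))

/-- `C₄(d) = π ^ (d / 2) / Γ(d / 2 + 1)`, the volume of the unit ball of `ℝ^d`. -/
def C4 (d : ℕ) : ℝ := Real.pi ^ ((d : ℝ) / 2) / Real.Gamma ((d : ℝ) / 2 + 1)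

/-- `C₃(d) = (4 / (c C₄(d))) ^ (1 / d) (1 + 8 / (3 d))`, where `c u ^ d C₄(d)` bounds the mass of the
balls of radius `u` from below. -/
def C3 (c : ℝ) (d : ℕ) : ℝ := (4 / (c * C4 d)) ^ (1 / (d : ℝ)) * (1 + 8 / (3 * (d : ℝ)))

/-- The rank `N₀`: the first integer which is at least `2 ^ (1 / (ε - (1 - β)))`. -/
def N0 (ε β : ℝ) : ℕ := ⌈(2 : ℝ) ^ (1 / (ε - (1 - β)))⌉₊

/-- `κ_j = ∑_{i=1}^j i ^ (-ε - γ)`. -/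
def kappa (ε γ : ℝ) (j : ℕ) : ℝ := ∑ i ∈ Finset.Icc 1 j, (i : ℝ) ^ (-ε - γ)

/-- The remainder `d_n`; here `s = √C₁`, `Mx = M(x)` and `c₃ = C₃(d)`. -/
def remainder (s Mx c₃ γ β ε : ℝ) (d n : ℕ) : ℝ :=
  s ^ 2 * Real.exp (-(3 * (n : ℝ) ^ (1 - ε) / 8)) +
    2 * s * Mx * c₃ * stepSize γ n * ((numNeighbours β n : ℝ) / n) ^ (1 / (d : ℝ) + 1) +
    stepSize γ n ^ 2 * ((numNeighbours β n : ℝ) / n)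

end

/-!
Let `T` be the error of the current estimate `θ_n`, let `N = n + 1`, and let `p` be the mass under
the law of `X` of the ball centred at `x` that reaches the `k_N`-th neighbour among the first `n` inputs
(`kthMass`). Conditionally on the past, the next observation moves the estimate only if its input
falls into this ball, and then the mean drift is the distribution function of the output given that
ball, minus `α`. By A1 it differs from the distribution function of the output at `x` by at most
`M(x)` times the radius, and the latter is monotone with slope at least `C₂` around the quantile
(`C2_mul_sq_le`). This bounds the conditional mean of the new squared error by
`T² - 2 C₂ γ_N p T² + 2 γ_N √C₁ M(x) r p + γ_N² p` (`integral_step_sq_le`).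

The random mass `p` is the order statistic of a uniform sample, and only three facts about it
are needed; none of them uses its Beta law explicitly.
* Its first two moments are bounded by exchangeability (`lintegral_symmetric_le`): the last of
  `n + 1` points has probability at most `k / (n + 1)` of being among the `k` nearest. Spheres are
  null sets, so there are no ties.
* The radius is at most a constant times `p ^ (1 / d)`, by the filling condition and the lower bound
  on the density (`exists_kthDistance_eq_ofReal`). The mean of `r p` is then controlled by the moment
  of order `1 + 1 / d` of `p`, which is interpolated between the first two.
* `p` is rarely below `N ^ (-ε)`, because then at least `k_N` of the first `n` points lie in a
  set of mass at most `N ^ (-ε)`; this is Chernoff's bound (`measure_kthMass_lt_le`). The integer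
  part in `k_N` costs a factor `2`, which is absorbed by the factor `N ^ (-ε)` that multiplies the
  probability (`two_mul_mul_one_add_pow_le`).

Integrating gives `a_N ≤ (1 - 2 C₂ N ^ (-ε - γ)) a_{N - 1} + d_N` (`integral_theta_succ_le`),
which is unrolled with `1 - u ≤ exp (-u)` (`le_of_recursion`). The last term of the bound is not needed: it
is only added because it is nonnegative.
-/

/-! ### Order statistics of the distances -/

theorem card_filter_range_comp_perm {n : ℕ} (σ : Equiv.Perm ℕ) (hσ : ∀ i, i < n ↔ σ i < n)
    (p : ℕ → Prop) [DecidablePred p] :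
    ((Finset.range n).filter (fun i => p (σ i))).card = ((Finset.range n).filter p).card := by
  refine Finset.card_bij (fun i _ => σ i) ?_ (fun _ _ _ _ h => σ.injective h) ?_
  · intro i hi
    simp only [Finset.mem_filter, Finset.mem_range] at hi ⊢
    exact ⟨(hσ i).1 hi.1, hi.2⟩
  · intro i hi
    simp only [Finset.mem_filter, Finset.mem_range] at hi
    refine ⟨σ.symm i, ?_, by simp⟩
    simp only [Finset.mem_filter, Finset.mem_range, Equiv.apply_symm_apply]
    exact ⟨(hσ _).2 (by simpa using hi.1), hi.2⟩

section OrderStatistics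

variable {d : ℕ} {u v : ℕ → EuclideanSpace ℝ (Fin d)} {x : EuclideanSpace ℝ (Fin d)} {k n : ℕ}

theorem kthDistance_lt_iff (hk : 1 ≤ k) (a : ℝ≥0∞) :
    kthDistance u x k n < a ↔ k ≤ ((Finset.range n).filter (fun i => edist (u i) x < a)).card := by
  unfold kthDistance
  rw [sInf_lt_iff]
  constructor
  · rintro ⟨r, hr, hra⟩
    refine le_trans hr (Finset.card_le_card ?_)
    intro i hi
    simp only [Finset.mem_filter] at hi ⊢
    exact ⟨hi.1, hi.2.trans_lt hra⟩
  · intro h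
    have hne : ((Finset.range n).filter (fun i => edist (u i) x < a)).Nonempty :=
      Finset.card_pos.1 (by omega)
    obtain ⟨j, hj, hmax⟩ := Finset.exists_max_image _ (fun i => edist (u i) x) hne
    refine ⟨edist (u j) x, le_trans h (Finset.card_le_card ?_), (Finset.mem_filter.1 hj).2⟩
    intro i hi
    exact Finset.mem_filter.2 ⟨(Finset.mem_filter.1 hi).1, hmax i hi⟩

theorem le_kthDistance_iff (hk : 1 ≤ k) (a : ℝ≥0∞) :
    a ≤ kthDistance u x k n ↔
      ((Finset.range n).filter (fun i => edist (u i) x < a)).card < k := by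
  rw [← not_lt, kthDistance_lt_iff hk, not_le]

/-- With at least `k` points, the `k`-th smallest distance is attained by a sample point. -/
theorem exists_kthDistance_eq (hk : 1 ≤ k) (hkn : k ≤ n) :
    ∃ i < n, kthDistance u x k n = edist (u i) x ∧
      k ≤ ((Finset.range n).filter (fun j => edist (u j) x ≤ kthDistance u x k n)).card := by
  let I := (Finset.range n).filter (fun i =>
    k ≤ ((Finset.range n).filter (fun j => edist (u j) x ≤ edist (u i) x)).card)
  have hI : I.Nonempty := by
    obtain ⟨j, hj, hmax⟩ := Finset.exists_max_image (Finset.range n) (fun i => edist (u i) x)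
      ⟨0, Finset.mem_range.2 (by omega)⟩
    refine ⟨j, Finset.mem_filter.2 ⟨hj, ?_⟩⟩
    rw [Finset.filter_true_of_mem hmax]
    simpa using hkn
  obtain ⟨i, hi, hmin⟩ := Finset.exists_min_image I (fun i => edist (u i) x) hI
  have hi' := Finset.mem_filter.1 hi
  have heq : kthDistance u x k n = edist (u i) x := by
    refine le_antisymm (sInf_le hi'.2) ?_
    rw [le_kthDistance_iff hk]
    by_contra! hcon
    have hne : ((Finset.range n).filter (fun j => edist (u j) x < edist (u i) x)).Nonempty :=
      Finset.card_pos.1 (by omega)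
    obtain ⟨j, hj, hmax⟩ := Finset.exists_max_image _ (fun i => edist (u i) x) hne
    have hj' := Finset.mem_filter.1 hj
    refine absurd (hmin j (Finset.mem_filter.2 ⟨hj'.1, hcon.trans (Finset.card_le_card ?_)⟩))
      (not_le.2 hj'.2)
    intro l hl
    exact Finset.mem_filter.2 ⟨(Finset.mem_filter.1 hl).1, hmax l hl⟩
  refine ⟨i, Finset.mem_range.1 hi'.1, heq, ?_⟩
  rw [heq]
  exact hi'.2

theorem kthDistance_le_succ : kthDistance u x k n ≤ kthDistance u x (k + 1) (n + 1) := by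
  refine sInf_le_sInf fun r hr => ?_
  simp only [Set.mem_ofPred_eq, Finset.range_add_one, Finset.filter_insert] at hr ⊢
  split_ifs at hr
  · have := hr.trans (Finset.card_insert_le _ _)
    omega
  · omega

theorem kthDistance_congr (h : ∀ i < n, u i = v i) :
    kthDistance u x k n = kthDistance v x k n := by
  unfold kthDistance
  congr 1
  ext r
  rw [Set.mem_ofPred_eq, Set.mem_ofPred_eq]
  have : (Finset.range n).filter (fun i => edist (u i) x ≤ r) =
      (Finset.range n).filter (fun i => edist (v i) x ≤ r) :=
    Finset.filter_congr fun i hi => by rw [h i (Finset.mem_range.1 hi)]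
  rw [this]

/-- An order statistic of `n` points does not depend on the order of the points. -/
theorem kthDistance_comp_perm (σ : Equiv.Perm ℕ) (hσ : ∀ i, i < n ↔ σ i < n) :
    kthDistance (fun i => u (σ i)) x k n = kthDistance u x k n := by
  unfold kthDistance
  congr 1
  ext r
  rw [Set.mem_ofPred_eq, Set.mem_ofPred_eq]
  rw [card_filter_range_comp_perm σ hσ (fun i => edist (u i) x ≤ r)]

theorem measurable_kthDistance (hk : 1 ≤ k) :
    Measurable (fun u : ℕ → EuclideanSpace ℝ (Fin d) => kthDistance u x k n) := by
  refine measurable_of_Iio fun a => ?_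
  have hm : Measurable (fun u : ℕ → EuclideanSpace ℝ (Fin d) =>
      ((Finset.range n).filter (fun i => edist (u i) x < a)).card) := by
    simp only [Finset.card_filter]
    refine Finset.measurable_sum _ fun i _ => ?_
    exact Measurable.ite (measurableSet_lt (by fun_prop) measurable_const) measurable_const
      measurable_const
  have : (fun u : ℕ → EuclideanSpace ℝ (Fin d) => kthDistance u x k n) ⁻¹' Iio a =
      {u | k ≤ ((Finset.range n).filter (fun i => edist (u i) x < a)).card} := by
    ext u
    exact kthDistance_lt_iff hk a
  rw [this]
  exact measurableSet_le measurable_const hm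

end OrderStatistics

/-- Among points with distinct values, at most `k` have fewer than `k` points below them. -/
theorem card_filter_rank_lt_le {ι α : Type*} [LinearOrder α] (s : Finset ι) (f : ι → α)
    (hf : Set.InjOn f s) (k : ℕ) :
    (s.filter (fun i => (s.filter (fun j => f j < f i)).card < k)).card ≤ k := by
  calc _ ≤ (Finset.range k).card := by
        refine Finset.card_le_card_of_injOn (fun i => (s.filter (fun j => f j < f i)).card) ?_ ?_
        · intro i hi
          simpa using (Finset.mem_filter.1 hi).2
        · have key : ∀ i ∈ s, ∀ j ∈ s, f i < f j →
              (s.filter (fun l => f l < f i)).card < (s.filter (fun l => f l < f j)).card := by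
            intro i hi j _ hij
            refine Finset.card_lt_card (Finset.ssubset_iff_of_subset ?_ |>.2 ⟨i, ?_, ?_⟩)
            · intro l hl
              simp only [Finset.mem_filter] at hl ⊢
              exact ⟨hl.1, hl.2.trans hij⟩
            · simp [hi, hij]
            · simp
          intro i hi j hj hij
          have hi' := (Finset.mem_filter.1 hi).1
          have hj' := (Finset.mem_filter.1 hj).1
          refine hf hi' hj' ?_
          rcases lt_trichotomy (f i) (f j) with h | h | h
          · exact absurd hij (key i hi' j hj' h).ne
          · exact h
          · exact absurd hij (key j hj' i hi' h).ne'
    _ = k := Finset.card_range k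

/-! ### Deterministic properties of the algorithm -/

section Algorithm

variable {d : ℕ} {α γ β θ₀ LY UY : ℝ} {x : EuclideanSpace ℝ (Fin d)}

theorem theta_congr {u u' : ℕ → EuclideanSpace ℝ (Fin d)} {y y' : ℕ → ℝ} {n : ℕ}
    (hu : ∀ i < n, u i = u' i) (hy : ∀ i < n, y i = y' i) :
    theta α γ β θ₀ x u y n = theta α γ β θ₀ x u' y' n := by
  induction n with
  | zero => rfl
  | succ n ih =>
    rw [theta, theta, ih (fun i hi => hu i (by omega)) (fun i hi => hy i (by omega)),
      hu n (by omega), hy n (by omega), kthDistance_congr (fun i hi => hu i (by omega))]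

theorem stepSize_mem_Icc (hγ : 0 < γ) (n : ℕ) : stepSize γ n ∈ Icc (0 : ℝ) 1 := by
  unfold stepSize
  refine ⟨by positivity, ?_⟩
  rcases Nat.eq_zero_or_pos n with rfl | h
  · simp [Real.zero_rpow (neg_ne_zero.2 hγ.ne')]
  · exact Real.rpow_le_one_of_one_le_of_nonpos (by exact_mod_cast h) (by linarith)

theorem one_le_numNeighbours (hβ : 0 ≤ β) {n : ℕ} (hn : 1 ≤ n) : 1 ≤ numNeighbours β n := by
  unfold numNeighbours
  exact Nat.le_floor (by simpa using Real.one_le_rpow (by exact_mod_cast hn) hβ)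

theorem numNeighbours_lt (hβ : β < 1) {n : ℕ} (hn : 2 ≤ n) : numNeighbours β n < n := by
  unfold numNeighbours
  rw [Nat.floor_lt (by positivity)]
  have h1 : (1 : ℝ) < n := by exact_mod_cast hn
  simpa using Real.rpow_lt_rpow_of_exponent_lt h1 hβ

/-- A step goes up by at most `α` or down by at most `1 - α`, and from outside `[LY, UY]` it never
leads further away, because all outputs lie in `[LY, UY]`. -/
theorem theta_mem_Icc (hγ : 0 < γ) (hα : α ∈ Icc (0 : ℝ) 1)
    (hθ₀ : θ₀ ∈ Icc (LY - (1 - α)) (UY + α)) {u : ℕ → EuclideanSpace ℝ (Fin d)} {y : ℕ → ℝ}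
    (hy : ∀ i, y i ∈ Icc LY UY) (n : ℕ) :
    theta α γ β θ₀ x u y n ∈ Icc (LY - (1 - α)) (UY + α) := by
  induction n with
  | zero => exact hθ₀
  | succ n ih =>
    rw [theta]
    obtain ⟨h0, h1⟩ := stepSize_mem_Icc hγ (n + 1)
    obtain ⟨hy0, hy1⟩ := hy n
    obtain ⟨ha0, ha1⟩ := hα
    obtain ⟨ih0, ih1⟩ := ih
    set s := stepSize γ (n + 1)
    set t := theta α γ β θ₀ x u y n
    have e1 : 0 ≤ s * α := by positivity
    have e2 : s * α ≤ α := by nlinarith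
    have e3 : 0 ≤ s * (1 - α) := mul_nonneg h0 (by linarith)
    have e4 : s * (1 - α) ≤ 1 - α := by nlinarith
    split_ifs with c1 c2 c2 <;> constructor <;> nlinarith

theorem measurable_theta (hβ : 0 ≤ β) (n : ℕ) :
    Measurable (fun w : ℕ → EuclideanSpace ℝ (Fin d) × ℝ =>
      theta α γ β θ₀ x (fun i => (w i).1) (fun i => (w i).2) n) := by
  induction n with
  | zero => exact measurable_const
  | succ n ih =>
    simp only [theta]
    have hk : Measurable (fun w : ℕ → EuclideanSpace ℝ (Fin d) × ℝ =>
        kthDistance (fun i => (w i).1) x (numNeighbours β (n + 1)) n) :=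
      (measurable_kthDistance (one_le_numNeighbours hβ (by omega))).comp
        (measurable_pi_lambda _ fun i => by fun_prop)
    refine ih.sub (((measurable_const.mul ((Measurable.ite (measurableSet_le (by fun_prop) ih)
      measurable_const measurable_const).sub measurable_const))).mul
      (Measurable.ite (measurableSet_le (by fun_prop) hk) measurable_const measurable_const))

end Algorithm

/-! ### Independence of the past and the next observation -/

section Past

variable {Ω S : Type*} [MeasurableSpace Ω] [MeasurableSpace S] {P : Measure Ω}
  {Z : ℕ → Ω → S} {n : ℕ}

/-- The sequence `w` with all values from rank `n` on replaced by `s`. -/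
def truncateSeq (s : S) (n : ℕ) (w : ℕ → S) : ℕ → S := fun i => if i < n then w i else s

theorem measurable_truncateSeq (s : S) (n : ℕ) : Measurable (truncateSeq s n) := by
  refine measurable_pi_lambda _ fun i => ?_
  unfold truncateSeq
  split_ifs
  · exact measurable_pi_apply i
  · exact measurable_const

theorem indepFun_truncateSeq [IsProbabilityMeasure P]
    (hZ : ∀ i, Measurable (Z i)) (hind : iIndepFun Z P) (s : S) (n : ℕ) :
    IndepFun (fun ω => truncateSeq s n (fun i => Z i ω)) (Z n) P := by
  have h := hind.indepFun_finset (Finset.range n) {n} (by simp) hZ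
  have hφ : Measurable (fun (w : Finset.range n → S) (i : ℕ) =>
      if h : i ∈ Finset.range n then w ⟨i, h⟩ else s) := by
    refine measurable_pi_lambda _ fun i => ?_
    split_ifs
    · exact measurable_pi_apply _
    · exact measurable_const
  have hψ : Measurable (fun w : ({n} : Finset ℕ) → S => w ⟨n, by simp⟩) := measurable_pi_apply _
  have h2 := h.comp hφ hψ
  convert h2 using 1
  · funext ω i
    simp only [truncateSeq, Function.comp, Finset.mem_range]
    split_ifs <;> rfl
  · rfl

theorem map_truncateSeq_prodMk [IsProbabilityMeasure P]
    (hZ : ∀ i, Measurable (Z i)) (hind : iIndepFun Z P) (s : S)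
    (n : ℕ) :
    P.map (fun ω => (truncateSeq s n (fun i => Z i ω), Z n ω)) =
      (P.map (fun ω => truncateSeq s n (fun i => Z i ω))).prod (P.map (Z n)) :=
  (indepFun_iff_map_prod_eq_prod_map_map
    (((measurable_truncateSeq s n).comp (measurable_pi_lambda _ hZ)).aemeasurable)
    (hZ n).aemeasurable).1 (indepFun_truncateSeq hZ hind s n)

/-- Conditioning on the past: in a function of the first `n` observations and of the next one, the
latter can be integrated out separately. -/
theorem lintegral_past [IsProbabilityMeasure P] (hZ : ∀ i, Measurable (Z i)) (hind : iIndepFun Z P)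
    {F : (ℕ → S) → S → ℝ≥0∞} (hF : Measurable (Function.uncurry F))
    (hloc : ∀ w w', (∀ i < n, w i = w' i) → F w = F w') :
    ∫⁻ ω, F (fun i => Z i ω) (Z n ω) ∂P =
      ∫⁻ ω, ∫⁻ z, F (fun i => Z i ω) z ∂(P.map (Z n)) ∂P := by
  obtain ⟨ω₀⟩ : Nonempty Ω := nonempty_of_isProbabilityMeasure P
  have hT : Measurable (fun ω => truncateSeq (Z 0 ω₀) n (fun i => Z i ω)) :=
    (measurable_truncateSeq _ n).comp (measurable_pi_lambda _ hZ)
  have hpr := Measure.isProbabilityMeasure_map (μ := P) (hZ n).aemeasurable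
  have hloc' : ∀ ω, F (fun i => Z i ω) = F (truncateSeq (Z 0 ω₀) n (fun i => Z i ω)) := by
    intro ω
    refine hloc _ _ fun i hi => ?_
    simp [truncateSeq, hi]
  simp_rw [hloc']
  calc _ = ∫⁻ p, Function.uncurry F p
        ∂(P.map (fun ω => (truncateSeq (Z 0 ω₀) n (fun i => Z i ω), Z n ω))) :=
        (lintegral_map hF (hT.prodMk (hZ n))).symm
    _ = _ := by
        rw [map_truncateSeq_prodMk hZ hind, lintegral_prod _ hF.aemeasurable,
          lintegral_map hF.lintegral_prod_right' hT]
        rfl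

/-- The version of `lintegral_past` for integrable real-valued functions. -/
theorem integral_past [IsProbabilityMeasure P] (hZ : ∀ i, Measurable (Z i)) (hind : iIndepFun Z P)
    {F : (ℕ → S) → S → ℝ} (hF : Measurable (Function.uncurry F))
    (hloc : ∀ w w', (∀ i < n, w i = w' i) → F w = F w')
    (hint : Integrable (fun ω => F (fun i => Z i ω) (Z n ω)) P) :
    Integrable (fun ω => ∫ z, F (fun i => Z i ω) z ∂(P.map (Z n))) P ∧
    ∫ ω, F (fun i => Z i ω) (Z n ω) ∂P =
      ∫ ω, ∫ z, F (fun i => Z i ω) z ∂(P.map (Z n)) ∂P := by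
  obtain ⟨ω₀⟩ : Nonempty Ω := nonempty_of_isProbabilityMeasure P
  have hT : Measurable (fun ω => truncateSeq (Z 0 ω₀) n (fun i => Z i ω)) :=
    (measurable_truncateSeq _ n).comp (measurable_pi_lambda _ hZ)
  have hpr := Measure.isProbabilityMeasure_map (μ := P) (hZ n).aemeasurable
  have hloc' : ∀ ω, F (fun i => Z i ω) = F (truncateSeq (Z 0 ω₀) n (fun i => Z i ω)) := by
    intro ω
    refine hloc _ _ fun i hi => ?_
    simp [truncateSeq, hi]
  simp_rw [hloc'] at hint ⊢
  have hpair := hT.prodMk (hZ n)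
  have hint' : Integrable (Function.uncurry F)
      ((P.map (fun ω => truncateSeq (Z 0 ω₀) n (fun i => Z i ω))).prod (P.map (Z n))) := by
    rw [← map_truncateSeq_prodMk hZ hind,
      integrable_map_measure hF.aestronglyMeasurable hpair.aemeasurable]
    exact hint
  have hI := hint'.integral_prod_left
  refine ⟨(integrable_map_measure hI.aestronglyMeasurable hT.aemeasurable).1 hI, ?_⟩
  calc _ = ∫ p, Function.uncurry F p
        ∂(P.map (fun ω => (truncateSeq (Z 0 ω₀) n (fun i => Z i ω), Z n ω))) :=
        (integral_map hpair.aemeasurable hF.aestronglyMeasurable).symm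
    _ = _ := by
        rw [map_truncateSeq_prodMk hZ hind, integral_prod _ hint',
          integral_map hT.aemeasurable hI.aestronglyMeasurable]
        rfl

/-- An i.i.d. sequence is exchangeable. -/
theorem lintegral_comp_perm (hZ : ∀ i, Measurable (Z i)) (hind : iIndepFun Z P)
    {L : Measure S} (hlaw : ∀ i, P.map (Z i) = L) (σ : Equiv.Perm ℕ)
    {H : (ℕ → S) → ℝ≥0∞} (hH : Measurable H) :
    ∫⁻ ω, H (fun i => Z (σ i) ω) ∂P = ∫⁻ ω, H (fun i => Z i ω) ∂P := by
  rw [← lintegral_map hH (measurable_pi_lambda _ fun i => hZ (σ i)),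
    ← lintegral_map hH (measurable_pi_lambda _ hZ), hind.map_fun_eq_infinitePi_map hZ,
    (hind.precomp σ.injective).map_fun_eq_infinitePi_map (fun i => hZ (σ i))]
  simp only [hlaw]

end Past

/-! ### The mass of the ball reaching the `k`-th neighbour -/

section Mass

variable {d : ℕ} {μ : Measure (EuclideanSpace ℝ (Fin d))}
  {x : EuclideanSpace ℝ (Fin d)} {k n : ℕ}

/-- The mass under `μ` of the closed ball centred at `x` whose radius is the distance from `x` to
the `k`-th nearest of the points `u 0, …, u (n - 1)`. -/
noncomputable def kthMass (μ : Measure (EuclideanSpace ℝ (Fin d))) (x : EuclideanSpace ℝ (Fin d))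
    (k n : ℕ) (u : ℕ → EuclideanSpace ℝ (Fin d)) : ℝ≥0∞ :=
  μ {z | edist z x ≤ kthDistance u x k n}

theorem measurableSet_edist_le (x : EuclideanSpace ℝ (Fin d)) (r : ℝ≥0∞) :
    MeasurableSet {z : EuclideanSpace ℝ (Fin d) | edist z x ≤ r} :=
  measurableSet_le (by fun_prop) measurable_const

theorem kthMass_eq_lintegral (u : ℕ → EuclideanSpace ℝ (Fin d)) :
    kthMass μ x k n u = ∫⁻ z, (if edist z x ≤ kthDistance u x k n then 1 else 0) ∂μ := by
  rw [kthMass, ← lintegral_indicator_one (measurableSet_edist_le x _)]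
  simp only [indicator_apply, mem_ofPred_eq, Pi.one_apply]

theorem measurableSet_edist_le_kthDistance (hk : 1 ≤ k) :
    MeasurableSet {p : (ℕ → EuclideanSpace ℝ (Fin d)) × EuclideanSpace ℝ (Fin d) |
      edist p.2 x ≤ kthDistance p.1 x k n} :=
  measurableSet_le (by fun_prop) ((measurable_kthDistance hk).comp measurable_fst)

theorem measurable_kthMass [IsProbabilityMeasure μ]
    (hk : 1 ≤ k) : Measurable (kthMass μ x k n) := by
  have : kthMass μ x k n = fun u => ∫⁻ z, (if edist z x ≤ kthDistance u x k n then 1 else 0) ∂μ :=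
    funext kthMass_eq_lintegral
  rw [this]
  have hm : Measurable (fun p : (ℕ → EuclideanSpace ℝ (Fin d)) × EuclideanSpace ℝ (Fin d) =>
      if edist p.2 x ≤ kthDistance p.1 x k n then (1 : ℝ≥0∞) else 0) :=
    Measurable.ite (measurableSet_edist_le_kthDistance hk) measurable_const measurable_const
  exact hm.lintegral_prod_right'

theorem kthMass_le_one [IsProbabilityMeasure μ]
    (u : ℕ → EuclideanSpace ℝ (Fin d)) : kthMass μ x k n u ≤ 1 := prob_le_one

theorem kthMass_le_succ (u : ℕ → EuclideanSpace ℝ (Fin d)) :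
    kthMass μ x k n u ≤ kthMass μ x (k + 1) (n + 1) u :=
  measure_mono fun _ hz => le_trans hz kthDistance_le_succ

variable {Ω : Type*} [MeasurableSpace Ω] {P : Measure Ω}
  {X : ℕ → Ω → EuclideanSpace ℝ (Fin d)}

/-- Conditionally on the first `n` points, the next one is among the `k` nearest with probability
`kthMass`. -/
theorem lintegral_mul_kthMass [IsProbabilityMeasure P] [IsProbabilityMeasure μ]
    (hX : ∀ i, Measurable (X i)) (hind : iIndepFun X P)
    (hlaw : ∀ i, P.map (X i) = μ) (hk : 1 ≤ k) {H : (ℕ → EuclideanSpace ℝ (Fin d)) → ℝ≥0∞}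
    (hH : Measurable H) (hloc : ∀ u v, (∀ i < n, u i = v i) → H u = H v) :
    ∫⁻ ω, H (fun i => X i ω) * kthMass μ x k n (fun i => X i ω) ∂P =
      ∫⁻ ω, (if edist (X n ω) x ≤ kthDistance (fun i => X i ω) x k n
        then H (fun i => X i ω) else 0) ∂P := by
  rw [lintegral_past (F := fun u z => if edist z x ≤ kthDistance u x k n then H u else 0) hX hind]
  · refine lintegral_congr fun ω => ?_
    rw [hlaw, kthMass_eq_lintegral, ← lintegral_const_mul]
    · simp
    · exact Measurable.ite (measurableSet_edist_le x _) measurable_const measurable_const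
  · exact Measurable.ite (measurableSet_edist_le_kthDistance hk) (hH.comp measurable_fst)
      measurable_const
  · intro u v huv
    funext z
    rw [kthDistance_congr huv, hloc u v huv]

/-- Points drawn independently from an absolutely continuous law have distinct distances to `x`,
because spheres are Lebesgue-null. -/
theorem ae_edist_ne [IsProbabilityMeasure P] [IsProbabilityMeasure μ]
    (hd : 0 < d) (hμ : μ ≪ volume) (hX : ∀ i, Measurable (X i))
    (hind : iIndepFun X P) (hlaw : ∀ i, P.map (X i) = μ) :
    ∀ᵐ ω ∂P, ∀ i j, i ≠ j → edist (X i ω) x ≠ edist (X j ω) x := by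
  have : NeZero d := ⟨hd.ne'⟩
  rw [ae_all_iff]
  intro i
  rw [ae_all_iff]
  intro j
  by_cases hij : i = j
  · simp [hij]
  have hS : MeasurableSet {p : EuclideanSpace ℝ (Fin d) × EuclideanSpace ℝ (Fin d) |
      edist p.1 x = edist p.2 x} := measurableSet_eq_fun (by fun_prop) (by fun_prop)
  have h0 : (μ.prod μ) {p | edist p.1 x = edist p.2 x} = 0 := by
    rw [Measure.measure_prod_null hS]
    refine Filter.Eventually.of_forall fun a => ?_
    refine hμ (measure_mono_null ?_ (Measure.addHaar_sphere volume x (dist a x)))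
    intro b hb
    have hb' : edist a x = edist b x := hb
    rw [edist_dist, edist_dist, ENNReal.ofReal_eq_ofReal_iff dist_nonneg dist_nonneg] at hb'
    exact hb'.symm
  have hm := (indepFun_iff_map_prod_eq_prod_map_map (hX i).aemeasurable (hX j).aemeasurable).1
    (hind.indepFun hij)
  rw [hlaw, hlaw] at hm
  rw [← hm, Measure.map_apply ((hX i).prodMk (hX j)) hS] at h0
  filter_upwards [compl_mem_ae_iff.2 h0] with ω hω _
  exact hω

/-- Exchangeability: by symmetry, the last of `n + 1` points is among the `k` nearest to `x` of
them with probability at most `k / (n + 1)`, and this remains true after weighting by a symmetric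
function `H` of the points. -/
theorem lintegral_symmetric_le [IsProbabilityMeasure P] [IsProbabilityMeasure μ]
    (hd : 0 < d) (hμ : μ ≪ volume) (hX : ∀ i, Measurable (X i))
    (hind : iIndepFun X P) (hlaw : ∀ i, P.map (X i) = μ) (hk : 1 ≤ k)
    {H : (ℕ → EuclideanSpace ℝ (Fin d)) → ℝ≥0∞} (hH : Measurable H)
    (hsymm : ∀ σ : Equiv.Perm ℕ, (∀ i, i < n + 1 ↔ σ i < n + 1) →
      ∀ u, H (fun i => u (σ i)) = H u) :
    (n + 1) * ∫⁻ ω, (if edist (X n ω) x ≤ kthDistance (fun i => X i ω) x k n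
        then H (fun i => X i ω) else 0) ∂P ≤ k * ∫⁻ ω, H (fun i => X i ω) ∂P := by
  let G : ℕ → (ℕ → EuclideanSpace ℝ (Fin d)) → ℝ≥0∞ := fun i u =>
    if ((Finset.range (n + 1)).filter (fun j => edist (u j) x < edist (u i) x)).card < k
      then H u else 0
  have hGm : ∀ i, Measurable (G i) := by
    intro i
    refine Measurable.ite (measurableSet_lt ?_ measurable_const) hH measurable_const
    simp only [Finset.card_filter]
    refine Finset.measurable_sum _ fun j _ => ?_
    exact Measurable.ite (measurableSet_lt (by fun_prop) (by fun_prop)) measurable_const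
      measurable_const
  have hlast : ∀ u : ℕ → EuclideanSpace ℝ (Fin d),
      (if edist (u n) x ≤ kthDistance u x k n then H u else 0) = G n u := by
    intro u
    simp only [G, le_kthDistance_iff hk, Finset.range_add_one, Finset.filter_insert, lt_irrefl,
      if_false]
  have hG : ∀ i ∈ Finset.range (n + 1),
      ∫⁻ ω, G i (fun j => X j ω) ∂P = ∫⁻ ω, G n (fun j => X j ω) ∂P := by
    intro i hi
    rw [Finset.mem_range] at hi
    have hσ : ∀ j, j < n + 1 ↔ Equiv.swap i n j < n + 1 := by
      intro j
      rw [Equiv.swap_apply_def]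
      split_ifs <;> omega
    rw [← lintegral_comp_perm hX hind hlaw (Equiv.swap i n) (hGm n)]
    refine lintegral_congr fun ω => ?_
    simp only [G, Equiv.swap_apply_right]
    rw [card_filter_range_comp_perm _ hσ (fun j => edist (X j ω) x < edist (X i ω) x),
      hsymm _ hσ (fun j => X j ω)]
  calc _ = ∑ i ∈ Finset.range (n + 1), ∫⁻ ω, G i (fun j => X j ω) ∂P := by
        rw [Finset.sum_congr rfl hG, Finset.sum_const, Finset.card_range, nsmul_eq_mul]
        rw [lintegral_congr fun ω => hlast (fun j => X j ω)]
        push_cast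
        rfl
    _ = ∫⁻ ω, ∑ i ∈ Finset.range (n + 1), G i (fun j => X j ω) ∂P := by
        rw [lintegral_finsetSum]
        exact fun i _ => (hGm i).comp (measurable_pi_lambda _ hX)
    _ ≤ ∫⁻ ω, k * H (fun i => X i ω) ∂P := by
        refine lintegral_mono_ae ?_
        filter_upwards [ae_edist_ne (x := x) hd hμ hX hind hlaw] with ω hω
        simp only [G, ← Finset.sum_filter, Finset.sum_const, nsmul_eq_mul]
        gcongr
        refine card_filter_rank_lt_le _ (fun i => edist (X i ω) x) ?_ k
        intro i _ j _ hij
        by_contra hne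
        exact hω i j hne hij
    _ = _ := by
        rw [lintegral_const_mul]
        exact hH.comp (measurable_pi_lambda _ hX)

theorem lintegral_kthMass_le [IsProbabilityMeasure P] [IsProbabilityMeasure μ]
    (hd : 0 < d) (hμ : μ ≪ volume) (hX : ∀ i, Measurable (X i))
    (hind : iIndepFun X P) (hlaw : ∀ i, P.map (X i) = μ) (hk : 1 ≤ k) :
    (n + 1) * ∫⁻ ω, kthMass μ x k n (fun i => X i ω) ∂P ≤ k := by
  have h1 := lintegral_mul_kthMass (x := x) (n := n) hX hind hlaw hk (H := fun _ => 1)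
    measurable_const (fun _ _ _ => rfl)
  have h2 := lintegral_symmetric_le (x := x) (n := n) hd hμ hX hind hlaw hk (H := fun _ => 1)
    measurable_const (fun _ _ _ => rfl)
  rw [← h1] at h2
  simpa using h2

/-- The second moment of the mass. Once the next point is among the `k` nearest of the first `n`,
the `k`-th distance is at most the `(k + 1)`-th among `n + 1` points, so exchangeability can be
used twice. -/
theorem lintegral_kthMass_sq_le [IsProbabilityMeasure P] [IsProbabilityMeasure μ]
    (hd : 0 < d) (hμ : μ ≪ volume) (hX : ∀ i, Measurable (X i))
    (hind : iIndepFun X P) (hlaw : ∀ i, P.map (X i) = μ) (hk : 1 ≤ k) :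
    (n + 2) * ((n + 1) * ∫⁻ ω, kthMass μ x k n (fun i => X i ω) ^ 2 ∂P) ≤ (k + 1) * k := by
  have h1 := lintegral_mul_kthMass (x := x) (n := n) hX hind hlaw hk (H := kthMass μ x k n)
    (measurable_kthMass hk) (fun u v h => by rw [kthMass, kthMass, kthDistance_congr h])
  have h2 := lintegral_symmetric_le (x := x) (n := n) hd hμ hX hind hlaw hk
    (H := kthMass μ x (k + 1) (n + 1)) (measurable_kthMass (by omega))
    (fun σ hσ u => by rw [kthMass, kthMass, kthDistance_comp_perm σ hσ])
  have h3 := lintegral_kthMass_le (x := x) (n := n + 1) (k := k + 1) hd hμ hX hind hlaw (by omega)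
  push_cast at h3
  have h4 : (n + 1) * ∫⁻ ω, kthMass μ x k n (fun i => X i ω) ^ 2 ∂P ≤
      k * ∫⁻ ω, kthMass μ x (k + 1) (n + 1) (fun i => X i ω) ∂P := by
    refine le_trans ?_ h2
    simp_rw [sq]
    rw [h1]
    refine mul_le_mul_right (lintegral_mono fun ω => ?_) _
    dsimp only
    split_ifs
    · exact kthMass_le_succ _
    · exact le_rfl
  calc (n + 2) * ((n + 1) * ∫⁻ ω, kthMass μ x k n (fun i => X i ω) ^ 2 ∂P)
      ≤ (n + 2) * (k * ∫⁻ ω, kthMass μ x (k + 1) (n + 1) (fun i => X i ω) ∂P) := by gcongr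
    _ = ((n + 1 + 1) * ∫⁻ ω, kthMass μ x (k + 1) (n + 1) (fun i => X i ω) ∂P) * k := by
        rw [show ((n : ℝ≥0∞) + 1 + 1) = n + 2 by rw [add_assoc, one_add_one_eq_two]]
        ring
    _ ≤ (k + 1) * k := by gcongr

/-- The points `u` for which the ball centred at `x` and reaching `u` has mass less than `p` have
total mass at most `p`. -/
theorem measure_setOf_measure_lt_le (p : ℝ≥0∞) :
    μ {u | μ {z | edist z x ≤ edist u x} < p} ≤ p := by
  set D := {u | μ {z | edist z x ≤ edist u x} < p} with hD
  rcases D.eq_empty_or_nonempty with h | h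
  · simp [h]
  obtain ⟨r, hmono, -, hlim, hmem⟩ :=
    (isLUB_sSup ((fun u => edist u x) '' D)).exists_seq_monotone_tendsto (h.image _)
  have hr : ∀ j, μ {z | edist z x ≤ r j} ≤ p := by
    intro j
    obtain ⟨u, hu, huj⟩ := hmem j
    rw [← huj]
    exact le_of_lt hu
  by_cases hs : sSup ((fun u => edist u x) '' D) ∈ (fun u => edist u x) '' D
  · obtain ⟨u, hu, hus⟩ := hs
    refine (measure_mono fun v hv => ?_).trans (le_of_lt hu)
    change edist v x ≤ edist u x
    rw [show edist u x = _ from hus]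
    exact le_sSup ⟨v, hv, rfl⟩
  · have hsub : D ⊆ ⋃ j, {z | edist z x ≤ r j} := by
      intro v hv
      have hlt : edist v x < sSup ((fun u => edist u x) '' D) :=
        lt_of_le_of_ne (le_sSup ⟨v, hv, rfl⟩) fun h => hs (h ▸ ⟨v, hv, rfl⟩)
      obtain ⟨j, hj⟩ := (hlim.eventually (lt_mem_nhds hlt)).exists
      exact mem_iUnion.2 ⟨j, hj.le⟩
    refine (measure_mono hsub).trans ?_
    rw [Monotone.measure_iUnion]
    · exact iSup_le hr
    · exact fun i j hij z hz => le_trans hz (hmono hij)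

/-- Chernoff's bound at `log 2`: if the mass is below `p` then at least `k` of the `n` points fall
into a set of mass at most `p`. -/
theorem measure_kthMass_lt_le [IsProbabilityMeasure μ]
    (hX : ∀ i, Measurable (X i)) (hind : iIndepFun X P)
    (hlaw : ∀ i, P.map (X i) = μ) (hk : 1 ≤ k) (hkn : k ≤ n) (p : ℝ≥0∞) :
    2 ^ k * P {ω | kthMass μ x k n (fun i => X i ω) < p} ≤ (1 + p) ^ n := by
  classical
  set D := {u | μ {z | edist z x ≤ edist u x} < p} with hD
  have hDm : MeasurableSet D := by
    refine measurableSet_lt ?_ measurable_const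
    have hm : MeasurableSet {q : EuclideanSpace ℝ (Fin d) × EuclideanSpace ℝ (Fin d) |
        edist q.2 x ≤ edist q.1 x} := measurableSet_le (by fun_prop) (by fun_prop)
    exact measurable_measure_prodMk_left hm
  let f : EuclideanSpace ℝ (Fin d) → ℝ≥0∞ := fun u => if u ∈ D then 2 else 1
  have hf : Measurable f := Measurable.ite hDm measurable_const measurable_const
  have hfμ : ∫⁻ u, f u ∂μ ≤ 1 + p := by
    have : ∀ u, f u = 1 + D.indicator 1 u := by
      intro u
      by_cases hu : u ∈ D <;> simp [f, hu, one_add_one_eq_two]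
    simp_rw [this]
    rw [lintegral_add_left measurable_const, lintegral_indicator_one hDm]
    simpa using measure_setOf_measure_lt_le p
  have hprod : ∫⁻ ω, ∏ i ∈ Finset.range n, f (X i ω) ∂P ≤ (1 + p) ^ n := by
    rw [lintegral_prod_eq_prod_lintegral_of_indepFun (Finset.range n) (fun i ω => f (X i ω))
      (hind.comp (fun _ => f) fun _ => hf) (fun i => hf.comp (hX i))]
    calc _ = ∏ _i ∈ Finset.range n, ∫⁻ u, f u ∂μ := by
          refine Finset.prod_congr rfl fun i _ => ?_
          rw [← hlaw i, lintegral_map hf (hX i)]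
      _ ≤ _ := by
          rw [Finset.prod_const, Finset.card_range]
          gcongr
  refine le_trans ?_ hprod
  refine le_trans (mul_le_mul_right (measure_mono fun ω (hω : _ < p) => ?_) _)
    (mul_meas_ge_le_lintegral (Finset.measurable_prod _ fun i _ => hf.comp (hX i)) _)
  obtain ⟨i₀, -, -, hcard⟩ := exists_kthDistance_eq (u := fun i => X i ω) (x := x) hk hkn
  have hsub : (Finset.range n).filter
        (fun j => edist (X j ω) x ≤ kthDistance (fun i => X i ω) x k n) ⊆
      (Finset.range n).filter (fun j => X j ω ∈ D) := by
    intro j hj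
    simp only [Finset.mem_filter] at hj ⊢
    exact ⟨hj.1, (measure_mono fun z hz => le_trans hz hj.2).trans_lt hω⟩
  change (2 : ℝ≥0∞) ^ k ≤ ∏ i ∈ Finset.range n, f (X i ω)
  rw [Finset.prod_ite, Finset.prod_const, Finset.prod_const_one, mul_one]
  exact pow_le_pow_right₀ (by norm_num) (hcard.trans (Finset.card_le_card hsub))

end Mass

/-! ### Numerical estimates -/

theorem four_mul_mul_one_add_pow_le_exp {p : ℝ} (hp : 0 ≤ p) (hp2 : p ≤ 1 / 2) :
    4 * p * (1 + p) ^ 3 ≤ Real.exp (4 * p) := by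
  refine le_trans ?_ (Real.sum_le_exp_of_nonneg (by positivity : (0 : ℝ) ≤ 4 * p) 5)
  simp only [Finset.sum_range_succ, Finset.sum_range_zero, Nat.factorial]
  push_cast
  have h1 : p ^ 3 ≤ p ^ 2 / 2 := by nlinarith [sq_nonneg p]
  nlinarith [sq_nonneg (p ^ 2 - 0.36), sq_nonneg p]

/-- Chernoff's bound for a binomial variable with `N - 1` trials exceeding twice its mean, up to the
rounding of the threshold `k`. The rounding costs a factor `2`, which the factor `p` makes up for. -/
theorem two_mul_mul_one_add_pow_le {N k : ℕ} {p : ℝ} (hN : 4 ≤ N) (hp : 0 ≤ p) (hp2 : p ≤ 1 / 2)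
    (hk : 2 * (N * p) - 1 ≤ k) :
    2 * p * (1 + p) ^ (N - 1) ≤ 2 ^ k * Real.exp (-(3 * (N * p) / 8)) := by
  obtain ⟨m, rfl⟩ := Nat.exists_eq_add_of_le' hN
  have hlog := Real.log_two_gt_d9
  have h1 : Real.exp (((m + 4 : ℕ) : ℝ) * p) / 2 * Real.exp (3 * (((m + 4 : ℕ) : ℝ) * p) / 8) ≤
      2 ^ k := by
    have e2 : (2 : ℝ) ^ k = Real.exp (Real.log 2 * k) := by
      rw [mul_comm, Real.exp_nat_mul, Real.exp_log (by norm_num)]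
    have e3 : Real.exp (((m + 4 : ℕ) : ℝ) * p) / 2 = Real.exp (((m + 4 : ℕ) : ℝ) * p - Real.log 2) := by
      rw [Real.exp_sub, Real.exp_log (by norm_num)]
    rw [e2, e3, ← Real.exp_add, Real.exp_le_exp]
    have hx : 0 ≤ ((m + 4 : ℕ) : ℝ) * p := by positivity
    nlinarith
  have h2 : 4 * p * (1 + p) ^ (m + 3) ≤ Real.exp (((m + 4 : ℕ) : ℝ) * p) := by
    have h3 : (1 + p) ^ m ≤ Real.exp (m * p) := by
      rw [Real.exp_nat_mul]
      gcongr
      linarith [Real.add_one_le_exp p]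
    calc 4 * p * (1 + p) ^ (m + 3) = (4 * p * (1 + p) ^ 3) * (1 + p) ^ m := by ring
      _ ≤ Real.exp (4 * p) * Real.exp (m * p) := by
          gcongr
          exact four_mul_mul_one_add_pow_le_exp hp hp2
      _ = _ := by
          rw [← Real.exp_add]
          push_cast
          ring_nf
  have h4 : 2 * p * (1 + p) ^ (m + 4 - 1) ≤ Real.exp (((m + 4 : ℕ) : ℝ) * p) / 2 := by
    rw [show m + 4 - 1 = m + 3 by omega]
    linarith
  calc _ ≤ Real.exp (((m + 4 : ℕ) : ℝ) * p) / 2 := h4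
    _ = Real.exp (((m + 4 : ℕ) : ℝ) * p) / 2 * Real.exp (3 * (((m + 4 : ℕ) : ℝ) * p) / 8) *
        Real.exp (-(3 * (((m + 4 : ℕ) : ℝ) * p) / 8)) := by
        rw [mul_assoc, ← Real.exp_add]
        simp
    _ ≤ _ := by gcongr

theorem four_le_of_N0_lt {β ε : ℝ} (hβ : β < 1) (hε : 1 - β < ε) (hε1 : ε < 1) {n : ℕ}
    (hn : N0 ε β + 1 ≤ n) : 4 ≤ n := by
  have h1 : (2 : ℝ) < 2 ^ (1 / (ε - (1 - β))) := by
    have : (1 : ℝ) < 1 / (ε - (1 - β)) := by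
      rw [lt_div_iff₀ (by linarith)]
      linarith
    simpa using Real.rpow_lt_rpow_of_exponent_lt (by norm_num : (1 : ℝ) < 2) this
  have h2 : 2 < N0 ε β := by
    have := h1.trans_le (Nat.le_ceil _)
    unfold N0
    exact_mod_cast this
  omega

theorem two_mul_rpow_le_of_N0_le {β ε : ℝ} (hε : 1 - β < ε) {n : ℕ} (hn0 : 0 < n)
    (hn : N0 ε β ≤ n) : 2 * (n : ℝ) ^ (1 - ε) ≤ (n : ℝ) ^ β := by
  have hn0' : (0 : ℝ) < n := by exact_mod_cast hn0
  have h1 : (2 : ℝ) ^ (1 / (ε - (1 - β))) ≤ n :=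
    (Nat.le_ceil _).trans (by exact_mod_cast hn)
  have h2 : (2 : ℝ) ≤ (n : ℝ) ^ (ε - (1 - β)) := by
    have := Real.rpow_le_rpow (by positivity) h1 (by linarith : 0 ≤ ε - (1 - β))
    rwa [← Real.rpow_mul (by norm_num), one_div_mul_cancel (by linarith), Real.rpow_one] at this
  calc 2 * (n : ℝ) ^ (1 - ε) ≤ (n : ℝ) ^ (ε - (1 - β)) * (n : ℝ) ^ (1 - ε) := by gcongr
    _ = _ := by
        rw [← Real.rpow_add hn0']
        ring_nf

/-- Interpolation, by the weighted arithmetic-geometric mean inequality, of the moment of order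
`1 + 1 / d` between the first two. -/
theorem rpow_one_div_add_one_le {d : ℕ} (hd : 0 < d) {t q : ℝ} (ht : 0 ≤ t) (hq : 0 < q) :
    t ^ (1 / (d : ℝ) + 1) ≤
      q ^ (1 / (d : ℝ) + 1) * ((1 - 1 / (d : ℝ)) * (t / q) + 1 / (d : ℝ) * (t / q) ^ 2) := by
  have hd' : (1 : ℝ) ≤ d := by exact_mod_cast hd
  have h0 : 0 ≤ 1 / (d : ℝ) := by positivity
  have h1 : 1 / (d : ℝ) ≤ 1 := by
    rw [div_le_one (by linarith)]
    exact hd'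
  have hs : 0 ≤ t / q := by positivity
  have h2 := Real.geom_mean_le_arith_mean2_weighted (sub_nonneg.2 h1) h0 hs
    (sq_nonneg (t / q)) (by ring)
  have h3 : (t / q) ^ (1 - 1 / (d : ℝ)) * ((t / q) ^ 2) ^ (1 / (d : ℝ)) =
      (t / q) ^ (1 / (d : ℝ) + 1) := by
    rw [← Real.rpow_natCast, ← Real.rpow_mul hs, ← Real.rpow_add_of_nonneg hs (by linarith)
      (by positivity)]
    congr 1
    push_cast
    ring
  rw [h3] at h2
  calc t ^ (1 / (d : ℝ) + 1) = q ^ (1 / (d : ℝ) + 1) * (t / q) ^ (1 / (d : ℝ) + 1) := by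
        rw [← Real.mul_rpow hq.le hs, mul_div_cancel₀ _ hq.ne']
    _ ≤ _ := by gcongr

/-- The discrete Grönwall inequality behind the final bound. -/
theorem le_of_recursion {a t D : ℕ → ℝ} {A c : ℝ} {m : ℕ} (ha : ∀ j, 0 ≤ a j) (hm : a m ≤ A)
    (hrec : ∀ j, m ≤ j → a (j + 1) ≤ (1 - c * t (j + 1)) * a j + D (j + 1)) {n : ℕ}
    (hn : m ≤ n) :
    a n ≤ Real.exp (-c * (∑ i ∈ Finset.Icc 1 n, t i - ∑ i ∈ Finset.Icc 1 m, t i)) * A +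
      ∑ k ∈ Finset.Icc (m + 1) n,
        Real.exp (-c * (∑ i ∈ Finset.Icc 1 n, t i - ∑ i ∈ Finset.Icc 1 k, t i)) * D k := by
  induction n, hn using Nat.le_induction with
  | base => simpa using hm
  | succ n hn ih =>
    have hexp : ∀ s : ℝ, Real.exp (-c * (∑ i ∈ Finset.Icc 1 (n + 1), t i - s)) =
        Real.exp (-(c * t (n + 1))) * Real.exp (-c * (∑ i ∈ Finset.Icc 1 n, t i - s)) := by
      intro s
      rw [Finset.sum_Icc_succ_top (by omega), ← Real.exp_add]
      ring_nf
    calc a (n + 1) ≤ (1 - c * t (n + 1)) * a n + D (n + 1) := hrec n hn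
      _ ≤ Real.exp (-(c * t (n + 1))) * a n + D (n + 1) := by
          gcongr
          · exact ha n
          · linarith [Real.add_one_le_exp (-(c * t (n + 1)))]
      _ ≤ _ := by
          rw [Finset.sum_Icc_succ_top (by omega : m + 1 ≤ n + 1), sub_self, mul_zero,
            Real.exp_zero, one_mul, ← add_assoc]
          simp only [hexp]
          refine add_le_add_left ((mul_le_mul_of_nonneg_left ih (Real.exp_pos _).le).trans_eq ?_) _
          rw [mul_add, Finset.mul_sum]
          simp only [mul_assoc]

theorem C2_nonneg {c LY UY α : ℝ} (hc : 0 ≤ c) (hLU : LY ≤ UY) (hα : α ∈ Ico (1 / 2 : ℝ) 1) :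
    0 ≤ C2 c LY UY α :=
  le_min hc (div_nonneg (by linarith [hα.2]) (by linarith [hα.1]))

theorem C2_le_one {c LY UY α : ℝ} (hLU : LY ≤ UY) (hα : α ∈ Ico (1 / 2 : ℝ) 1) :
    C2 c LY UY α ≤ 1 := by
  refine (min_le_right _ _).trans ?_
  rw [div_le_one (by linarith [hα.1])]
  linarith [hα.1]

/-! ### The law of the output at the input of interest -/

section Quantile

variable {L : Measure ℝ} [IsProbabilityMeasure L] {α LY UY c : ℝ}

theorem cdf_sub_cdf {s t : ℝ} (hst : s ≤ t) : cdf L t - cdf L s = L.real (Ioc s t) := by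
  rw [cdf_eq_real, cdf_eq_real, ← Iic_union_Ioc_eq_Iic hst,
    measureReal_union (Iic_disjoint_Ioc le_rfl) measurableSet_Ioc]
  ring

theorem continuous_cdf_of_absolutelyContinuous (hL : L ≪ volume) : Continuous (cdf L) := by
  have h : ∀ t, Function.leftLim (cdf L) t = cdf L t := by
    intro t
    have h0 : L {t} = 0 := hL (measure_singleton t)
    rw [← measure_cdf L, StieltjesFunction.measure_singleton, ENNReal.ofReal_eq_zero] at h0
    exact le_antisymm ((monotone_cdf L).leftLim_le le_rfl) (by linarith)
  rw [continuous_iff_continuousAt]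
  intro t
  rw [(monotone_cdf L).continuousAt_iff_leftLim_eq_rightLim, h, StieltjesFunction.rightLim_eq]

theorem cdf_quantile (hL : L ≪ volume) (hα : α ∈ Ioo (0 : ℝ) 1) : cdf L (quantile L α) = α := by
  have hc := continuous_cdf_of_absolutelyContinuous hL
  obtain ⟨t, ht⟩ : ∃ t, cdf L t = α :=
    mem_range_of_exists_le_of_exists_ge hc
      (((tendsto_cdf_atBot L).eventually (gt_mem_nhds hα.1)).exists.imp fun _ h => h.le)
      (((tendsto_cdf_atTop L).eventually (lt_mem_nhds hα.2)).exists.imp fun _ h => h.le)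
  have hbdd : BddBelow {t | α ≤ cdf L t} := by
    obtain ⟨b, hb⟩ := ((tendsto_cdf_atBot L).eventually (gt_mem_nhds hα.1)).exists
    refine ⟨b, fun s hs => ?_⟩
    by_contra! hlt
    exact absurd (hs.trans (monotone_cdf L hlt.le)) (not_le.2 hb)
  have hmem : quantile L α ∈ {t | α ≤ cdf L t} :=
    (isClosed_le continuous_const hc).csInf_mem ⟨t, ht.ge⟩ hbdd
  refine le_antisymm ?_ hmem
  rw [← ht]
  exact monotone_cdf L (ht ▸ csInf_le hbdd ht.ge)

theorem cdf_eq_one_of_le (hsupp : L (Icc LY UY)ᶜ = 0) {t : ℝ} (ht : UY ≤ t) : cdf L t = 1 := by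
  have h : ∀ᵐ y ∂L, y ∈ Iic t := by
    filter_upwards [(show ∀ᵐ y ∂L, y ∈ Icc LY UY from hsupp)] with y hy
    exact hy.2.trans ht
  rw [cdf_eq_real, measureReal_def, (mem_ae_iff_prob_eq_one measurableSet_Iic).1 h, ENNReal.toReal_one]

theorem cdf_eq_zero_of_lt (hsupp : L (Icc LY UY)ᶜ = 0) {t : ℝ} (ht : t < LY) : cdf L t = 0 := by
  rw [cdf_eq_real, measureReal_eq_zero_iff]
  refine measure_mono_null ?_ hsupp
  intro y hy hy'
  exact absurd (hy'.1.trans hy) (not_le.2 ht)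

theorem quantile_mem_Icc (hL : L ≪ volume) (hα : α ∈ Ioo (0 : ℝ) 1)
    (hsupp : L (Icc LY UY)ᶜ = 0) : quantile L α ∈ Icc LY UY := by
  have h := cdf_quantile hL hα
  constructor
  · by_contra! hlt
    rw [cdf_eq_zero_of_lt hsupp hlt] at h
    exact hα.1.ne h
  · by_contra! hlt
    have hbdd : BddBelow {t | α ≤ cdf L t} := by
      refine ⟨LY, fun s hs => ?_⟩
      by_contra! hlt
      have hs' : α ≤ cdf L s := hs
      rw [cdf_eq_zero_of_lt hsupp hlt] at hs'
      exact absurd hα.1 (not_lt.2 hs')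
    have : α ≤ cdf L UY := by
      rw [cdf_eq_one_of_le hsupp le_rfl]
      exact hα.2.le
    exact absurd (csInf_le hbdd this) (not_le.2 hlt)

/-- A density at least `c` on an interval of the support makes the distribution function grow at
rate at least `c` there. -/
theorem mul_sub_le_cdf_sub_cdf {f : ℝ → ℝ≥0∞} (hf : L = volume.withDensity f)
    (hc : ∀ y ∈ L.support, ENNReal.ofReal c ≤ f y) (hc0 : 0 ≤ c) {s t : ℝ} (hst : s ≤ t)
    (hsub : Icc s t ⊆ L.support) : c * (t - s) ≤ cdf L t - cdf L s := by
  rw [cdf_sub_cdf hst, measureReal_def, ← ENNReal.ofReal_le_iff_le_toReal (measure_ne_top _ _)]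
  calc ENNReal.ofReal (c * (t - s)) = ∫⁻ _ in Ioc s t, ENNReal.ofReal c := by
        rw [setLIntegral_const, Real.volume_Ioc, ENNReal.ofReal_mul hc0]
    _ ≤ ∫⁻ y in Ioc s t, f y :=
        setLIntegral_mono' measurableSet_Ioc fun y hy => hc y (hsub (Ioc_subset_Icc_self hy))
    _ = L (Ioc s t) := by
        conv_rhs => rw [hf]
        rw [withDensity_apply _ measurableSet_Ioc]

/-- The mean drift of the algorithm points towards the quantile, at least linearly: inside the
support thanks to the lower bound on the density, outside because the distribution function is
there `0` or `1`, at distance at least `1 - α` from `α`. -/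
theorem C2_mul_sq_le {f : ℝ → ℝ≥0∞} (hf : L = volume.withDensity f)
    (hc : ∀ y ∈ L.support, ENNReal.ofReal c ≤ f y) (hc0 : 0 ≤ c) (hconn : L.support.OrdConnected)
    (hα : α ∈ Ico (1 / 2 : ℝ) 1) (hLU : LY ≤ UY) {θ : ℝ}
    (hθ : |θ - quantile L α| ≤ sqrtC1 LY UY α) :
    C2 c LY UY α * (θ - quantile L α) ^ 2 ≤ (θ - quantile L α) * (cdf L θ - α) := by
  have hL : L ≪ volume := hf ▸ withDensity_absolutelyContinuous _ _
  have hq := cdf_quantile hL ⟨by linarith [hα.1], hα.2⟩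
  set q := quantile L α with hqdef
  have hs : 0 < UY + α - LY := by linarith [hα.1]
  obtain ⟨hα1, hα2⟩ := hα
  have h2c : C2 c LY UY α ≤ c := min_le_left _ _
  have h2s : C2 c LY UY α * sqrtC1 LY UY α ≤ 1 - α := by
    have : C2 c LY UY α ≤ (1 - α) / (UY + α - LY) := min_le_right _ _
    rwa [le_div_iff₀ hs] at this
  have hC2 : 0 ≤ C2 c LY UY α := C2_nonneg hc0 hLU ⟨hα1, hα2⟩
  obtain ⟨hθ1, hθ2⟩ := abs_le.1 hθ
  rcases le_total q θ with hle | hle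
  · have key : C2 c LY UY α * (θ - q) ≤ cdf L θ - α := by
      rcases (cdf_le_one L θ).lt_or_eq with h1 | h1
      · obtain ⟨b, hb, hbs⟩ := Measure.nonempty_inter_support_of_pos (μ := L) (s := Ioi θ) (by
          rw [pos_iff_ne_zero]
          intro h0
          rw [cdf_eq_real, ← compl_Ioi, probReal_compl_eq_one_sub measurableSet_Ioi,
            measureReal_def, h0] at h1
          simp at h1)
        obtain ⟨a, ha, has⟩ := Measure.nonempty_inter_support_of_pos (μ := L) (s := Iic q) (by
          rw [← ofReal_cdf, hq, ENNReal.ofReal_pos]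
          linarith)
        have := mul_sub_le_cdf_sub_cdf hf hc hc0 hle
          ((Icc_subset_Icc ha (le_of_lt hb)).trans (hconn.out has hbs))
        rw [hq] at this
        nlinarith
      · rw [h1]
        nlinarith
    nlinarith
  · have key : cdf L θ - α ≤ C2 c LY UY α * (θ - q) := by
      rcases (cdf_nonneg L θ).lt_or_eq with h1 | h1
      · obtain ⟨a, ha, has⟩ := Measure.nonempty_inter_support_of_pos (μ := L) (s := Iic θ) (by
          rw [← ofReal_cdf, ENNReal.ofReal_pos]
          exact h1)
        obtain ⟨b, hb, hbs⟩ := Measure.nonempty_inter_support_of_pos (μ := L) (s := Ioi q) (by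
          rw [pos_iff_ne_zero]
          intro h0
          rw [cdf_eq_real, ← compl_Ioi, probReal_compl_eq_one_sub measurableSet_Ioi,
            measureReal_def, h0] at hq
          simp at hq
          linarith)
        have := mul_sub_le_cdf_sub_cdf hf hc hc0 hle
          ((Icc_subset_Icc ha (le_of_lt hb)).trans (hconn.out has hbs))
        rw [hq] at this
        nlinarith
      · rw [← h1]
        nlinarith
    nlinarith

end Quantile

/-! ### Balls centred at the input of interest -/

section Geometry

variable {d : ℕ} {μ : Measure (EuclideanSpace ℝ (Fin d))} [IsProbabilityMeasure μ]
  {x : EuclideanSpace ℝ (Fin d)} {ρ Cinput : ℝ}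

theorem C4_pos (d : ℕ) : 0 < C4 d :=
  div_pos (by positivity) (Real.Gamma_pos_of_pos (by positivity))

theorem volume_closedBall_eq_C4 (hd : 0 < d) (x : EuclideanSpace ℝ (Fin d)) {r : ℝ} (hr : 0 ≤ r) :
    volume (Metric.closedBall x r) = ENNReal.ofReal (C4 d * r ^ d) := by
  have : Nonempty (Fin d) := ⟨⟨0, hd⟩⟩
  rw [EuclideanSpace.volume_closedBall, Fintype.card_fin, mul_comm (C4 d),
    ENNReal.ofReal_mul (by positivity), ENNReal.ofReal_pow hr, C4, Real.sqrt_eq_rpow,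
    ← Real.rpow_natCast (Real.pi ^ (1 / 2 : ℝ)), ← Real.rpow_mul Real.pi_pos.le,
    one_div_mul_eq_div]

/-- A point `u` of the support cannot be covered by a smaller ball centred at `x`, so all
smaller balls satisfy the filling condition; the bound passes to the limit. -/
theorem mul_dist_pow_le_measureReal (hd : 0 < d) (hA2 : AssumptionA2 μ Cinput) (hρ : 0 < ρ)
    (hfill : FillsBalls μ.support x ρ) {u : EuclideanSpace ℝ (Fin d)} (hu : u ∈ μ.support) :
    ρ * Cinput * C4 d * dist u x ^ d ≤ μ.real (Metric.closedBall x (dist u x)) := by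
  obtain ⟨hC, f, -, hμf, hf⟩ := hA2
  rcases (dist_nonneg (x := u) (y := x)).eq_or_lt' with h0 | h0
  · rw [h0, zero_pow hd.ne', mul_zero]
    exact measureReal_nonneg
  have hlim : Filter.Tendsto (fun r : ℝ => ρ * Cinput * C4 d * r ^ d)
      (nhdsWithin (dist u x) (Iio (dist u x))) (nhds (ρ * Cinput * C4 d * dist u x ^ d)) :=
    (Continuous.tendsto (by fun_prop) _).mono_left nhdsWithin_le_nhds
  refine le_of_tendsto hlim ?_
  filter_upwards [Ioo_mem_nhdsLT h0] with r hr
  have hnot : ¬ μ.support ⊆ Metric.closedBall x r := fun hsub => not_le.2 hr.2 (hsub hu)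
  have hm : MeasurableSet (μ.support ∩ Metric.closedBall x r) :=
    Measure.isClosed_support.measurableSet.inter Metric.isClosed_closedBall.measurableSet
  rw [measureReal_def, ← ENNReal.ofReal_le_iff_le_toReal (measure_ne_top _ _)]
  calc ENNReal.ofReal (ρ * Cinput * C4 d * r ^ d)
      = ENNReal.ofReal Cinput * (ENNReal.ofReal ρ * volume (Metric.closedBall x r)) := by
        rw [volume_closedBall_eq_C4 hd x hr.1.le, ← ENNReal.ofReal_mul hρ.le,
          ← ENNReal.ofReal_mul hC.le]
        ring_nf
    _ ≤ ENNReal.ofReal Cinput * volume (μ.support ∩ Metric.closedBall x r) := by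
        gcongr
        exact hfill r hr.1 hnot
    _ = ∫⁻ _ in μ.support ∩ Metric.closedBall x r, ENNReal.ofReal Cinput := by
        rw [setLIntegral_const]
    _ ≤ ∫⁻ z in μ.support ∩ Metric.closedBall x r, f z :=
        setLIntegral_mono' hm fun z hz => hf z hz.1
    _ = μ (μ.support ∩ Metric.closedBall x r) := by
        rw [← withDensity_apply _ hm, ← hμf]
    _ ≤ μ (Metric.closedBall x (dist u x)) :=
        measure_mono (inter_subset_right.trans (Metric.closedBall_subset_closedBall hr.2.le))

/-- The radius of the ball reaching the `k`-th neighbour is controlled by the mass of the ball. -/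
theorem exists_kthDistance_eq_ofReal (hd : 0 < d) (hA2 : AssumptionA2 μ Cinput) (hρ : 0 < ρ)
    (hfill : FillsBalls μ.support x ρ) {u : ℕ → EuclideanSpace ℝ (Fin d)}
    (hu : ∀ i, u i ∈ μ.support) {k n : ℕ} (hk : 1 ≤ k) (hkn : k ≤ n) :
    ∃ r : ℝ, 0 ≤ r ∧ (∀ z, edist z x ≤ kthDistance u x k n ↔ z ∈ Metric.closedBall x r) ∧
      (kthMass μ x k n u).toReal = μ.real (Metric.closedBall x r) ∧
      r ≤ (1 / (ρ * Cinput * C4 d)) ^ (1 / (d : ℝ)) *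
        (kthMass μ x k n u).toReal ^ (1 / (d : ℝ)) := by
  obtain ⟨i, -, hi, -⟩ := exists_kthDistance_eq (u := u) (x := x) hk hkn
  have hiff : ∀ z, edist z x ≤ kthDistance u x k n ↔ z ∈ Metric.closedBall x (dist (u i) x) := by
    intro z
    rw [hi, edist_dist, edist_dist, ENNReal.ofReal_le_ofReal_iff dist_nonneg, Metric.mem_closedBall]
  have hmass : (kthMass μ x k n u).toReal = μ.real (Metric.closedBall x (dist (u i) x)) := by
    rw [kthMass, measureReal_def]
    congr 2
    exact Set.ext hiff
  refine ⟨dist (u i) x, dist_nonneg, hiff, hmass, ?_⟩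
  have hpos : 0 < ρ * Cinput * C4 d := mul_pos (mul_pos hρ hA2.1) (C4_pos d)
  have h := mul_dist_pow_le_measureReal hd hA2 hρ hfill (hu i)
  rw [← hmass] at h
  rw [← Real.mul_rpow (by positivity) ENNReal.toReal_nonneg]
  calc dist (u i) x = (dist (u i) x ^ d) ^ (1 / (d : ℝ)) := by
        rw [one_div, Real.pow_rpow_inv_natCast dist_nonneg hd.ne']
    _ ≤ _ := by
        gcongr
        rw [one_div_mul_eq_div, le_div_iff₀ hpos]
        linarith

end Geometry

/-! ### One step of the algorithm -/

section Step

variable {d m : ℕ} {g : EuclideanSpace ℝ (Fin d) → EuclideanSpace ℝ (Fin m) → ℝ}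
  {μ : Measure (EuclideanSpace ℝ (Fin d))}
  {ν : Measure (EuclideanSpace ℝ (Fin m))} [IsProbabilityMeasure ν]

theorem measurable_pair_code (hg : Measurable (Function.uncurry g)) :
    Measurable (fun p : EuclideanSpace ℝ (Fin d) × EuclideanSpace ℝ (Fin m) =>
      (p.1, g p.1 p.2)) :=
  measurable_fst.prodMk hg

theorem isProbabilityMeasure_jointLaw [IsProbabilityMeasure μ]
    (hg : Measurable (Function.uncurry g)) :
    IsProbabilityMeasure (jointLaw g μ ν) :=
  Measure.isProbabilityMeasure_map (measurable_pair_code hg).aemeasurable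

theorem map_fst_jointLaw (hg : Measurable (Function.uncurry g)) :
    (jointLaw g μ ν).map Prod.fst = μ := by
  rw [jointLaw, Measure.map_map measurable_fst (measurable_pair_code hg)]
  exact measurePreserving_fst.map_eq

theorem isProbabilityMeasure_codeLaw (hg : Measurable (Function.uncurry g))
    (x : EuclideanSpace ℝ (Fin d)) : IsProbabilityMeasure (codeLaw g ν x) :=
  Measure.isProbabilityMeasure_map (hg.comp measurable_prodMk_left).aemeasurable

theorem cdf_localLaw [IsProbabilityMeasure μ]
    (hg : Measurable (Function.uncurry g)) {B : Set (EuclideanSpace ℝ (Fin d))}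
    (hB : MeasurableSet B) (hpos : 0 < μ.real B) (t : ℝ) :
    μ.real B * cdf (localLaw g μ ν B) t =
      (jointLaw g μ ν).real (Prod.fst ⁻¹' B ∩ Prod.snd ⁻¹' Iic t) := by
  have hJ := isProbabilityMeasure_jointLaw (μ := μ) (ν := ν) hg
  have hm : MeasurableSet (Prod.fst ⁻¹' B : Set (EuclideanSpace ℝ (Fin d) × ℝ)) :=
    measurable_fst hB
  have hμB : (jointLaw g μ ν) (Prod.fst ⁻¹' B) = μ B := by
    rw [← Measure.map_apply measurable_fst hB, map_fst_jointLaw hg]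
  have hne : (jointLaw g μ ν) (Prod.fst ⁻¹' B) ≠ 0 := by
    rw [hμB]
    intro h0
    rw [measureReal_def, h0] at hpos
    simp at hpos
  have := cond_isProbabilityMeasure hne
  have : IsProbabilityMeasure (localLaw g μ ν B) :=
    Measure.isProbabilityMeasure_map measurable_snd.aemeasurable
  rw [cdf_eq_real, localLaw, map_measureReal_apply measurable_snd measurableSet_Iic,
    measureReal_def _ (Prod.snd ⁻¹' Iic t), cond_apply hm, hμB, ENNReal.toReal_mul,
    ENNReal.toReal_inv, ← measureReal_def, ← measureReal_def, mul_inv_cancel_left₀ hpos.ne']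

open Classical in
/-- The conditional mean of the squared error after one step, when the present estimate is `θ` and
the ball of the neighbours is `closedBall x r`: the drift of the law at `x` contracts the error, and
A1 bounds the bias made by using the neighbours of `x`. -/
theorem integral_step_sq_le [IsProbabilityMeasure μ]
    (hd : 0 < d) (hg : Measurable (Function.uncurry g)) (hμ : μ ≪ volume)
    {M : EuclideanSpace ℝ (Fin d) → ℝ} (hA1 : AssumptionA1 g μ ν M)
    {x : EuclideanSpace ℝ (Fin d)} (hx : x ∈ μ.support) {α q s c σ θ r : ℝ}
    (hα : α ∈ Icc (0 : ℝ) 1) (hs : 0 ≤ s) (hr : 0 ≤ r) (hσ : |θ - q| ≤ σ)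
    (hdrift : c * (θ - q) ^ 2 ≤ (θ - q) * (cdf (codeLaw g ν x) θ - α)) :
    ∫ z, (θ - s * ((if z.2 ≤ θ then 1 else 0) - α) *
        (if z.1 ∈ Metric.closedBall x r then 1 else 0) - q) ^ 2 ∂(jointLaw g μ ν) ≤
      (θ - q) ^ 2 - 2 * c * s * μ.real (Metric.closedBall x r) * (θ - q) ^ 2 +
        2 * s * σ * M x * (r * μ.real (Metric.closedBall x r)) +
        s ^ 2 * μ.real (Metric.closedBall x r) := by
  have hJ := isProbabilityMeasure_jointLaw (μ := μ) (ν := ν) hg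
  set J := jointLaw g μ ν
  set B := Metric.closedBall x r
  have hB : MeasurableSet B := Metric.isClosed_closedBall.measurableSet
  set p := μ.real B with hp
  have hp0 : 0 ≤ p := measureReal_nonneg
  set B' : Set (EuclideanSpace ℝ (Fin d) × ℝ) := Prod.fst ⁻¹' B
  have hB' : MeasurableSet B' := measurable_fst hB
  set E : Set (EuclideanSpace ℝ (Fin d) × ℝ) := B' ∩ Prod.snd ⁻¹' Iic θ
  have hE : MeasurableSet E := hB'.inter (measurable_snd measurableSet_Iic)
  have hJB : J.real B' = p := by
    rw [hp, ← map_measureReal_apply measurable_fst hB, map_fst_jointLaw hg]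
  have hint : ∀ A : Set (EuclideanSpace ℝ (Fin d) × ℝ), MeasurableSet A →
      Integrable (A.indicator (1 : EuclideanSpace ℝ (Fin d) × ℝ → ℝ)) J :=
    fun A hA => (integrable_const 1).indicator hA
  have hi1 : Integrable (fun z => 2 * s * (θ - q) * (E.indicator (1 : EuclideanSpace ℝ (Fin d) × ℝ → ℝ) z -
      α * B'.indicator (1 : EuclideanSpace ℝ (Fin d) × ℝ → ℝ) z)) J :=
    ((hint E hE).sub ((hint B' hB').const_mul α)).const_mul _
  have hi0 : Integrable (fun z => (θ - q) ^ 2 - 2 * s * (θ - q) *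
      (E.indicator (1 : EuclideanSpace ℝ (Fin d) × ℝ → ℝ) z -
      α * B'.indicator (1 : EuclideanSpace ℝ (Fin d) × ℝ → ℝ) z)) J := (integrable_const _).sub hi1
  have hi2 : Integrable (fun z => s ^ 2 * B'.indicator (1 : EuclideanSpace ℝ (Fin d) × ℝ → ℝ) z) J :=
    (hint B' hB').const_mul _
  -- the factor `((if z.2 ≤ θ then 1 else 0) - α) ^ 2` of the quadratic part is bounded by `1`
  have hle : ∫ z, (θ - s * ((if z.2 ≤ θ then 1 else 0) - α) *
        (if z.1 ∈ B then 1 else 0) - q) ^ 2 ∂J ≤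
      (θ - q) ^ 2 - 2 * s * (θ - q) * (J.real E - α * p) + s ^ 2 * p := by
    have heq : ∫ z, ((θ - q) ^ 2 - 2 * s * (θ - q) * (E.indicator (1 : EuclideanSpace ℝ (Fin d) × ℝ → ℝ) z -
        α * B'.indicator (1 : EuclideanSpace ℝ (Fin d) × ℝ → ℝ) z) +
        s ^ 2 * B'.indicator (1 : EuclideanSpace ℝ (Fin d) × ℝ → ℝ) z) ∂J =
        (θ - q) ^ 2 - 2 * s * (θ - q) * (J.real E - α * p) + s ^ 2 * p := by
      rw [integral_add hi0 hi2, integral_sub (integrable_const _) hi1,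
        integral_const_mul, integral_const_mul, integral_sub (hint E hE) ((hint B' hB').const_mul α),
        integral_const_mul, integral_indicator_one hE, integral_indicator_one hB', hJB]
      simp
    rw [← heq]
    refine integral_mono_of_nonneg (Filter.Eventually.of_forall fun z => sq_nonneg _)
      (hi0.add hi2) (Filter.Eventually.of_forall fun z => ?_)
    have e1 : (1 - α) ^ 2 ≤ 1 := by nlinarith [hα.1, hα.2]
    have e2 : α ^ 2 ≤ 1 := by nlinarith [hα.1, hα.2]
    have e3 := mul_le_mul_of_nonneg_left e1 (sq_nonneg s)
    have e4 := mul_le_mul_of_nonneg_left e2 (sq_nonneg s)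
    by_cases h1 : z.1 ∈ B <;> by_cases h2 : z.2 ≤ θ
    · have h3 : z ∈ E := ⟨h1, h2⟩
      have h4 : z ∈ B' := h1
      simp only [h1, h2, h3, h4, if_true, indicator_of_mem, Pi.one_apply]
      nlinarith
    · have h3 : z ∉ E := fun h => h2 h.2
      have h4 : z ∈ B' := h1
      simp only [h1, h2, h3, h4, if_true, if_false, indicator_of_mem, Pi.one_apply,
        indicator_of_notMem, not_false_eq_true]
      nlinarith
    · have h3 : z ∉ E := fun h => h1 h.1
      have h4 : z ∉ B' := h1
      simp [h1, h3, h4]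
    · have h3 : z ∉ E := fun h => h1 h.1
      have h4 : z ∉ B' := h1
      simp [h1, h3, h4]
  refine hle.trans ?_
  rcases hp0.eq_or_lt with h0 | hpos
  · have hE0 : J.real E = 0 := by
      refine le_antisymm ?_ measureReal_nonneg
      calc J.real E ≤ J.real B' := measureReal_mono inter_subset_left
        _ = 0 := by rw [hJB, ← h0]
    rw [hE0, ← h0]
    simp
  · have hr0 : 0 < r := by
      refine lt_of_le_of_ne hr fun h => hpos.ne' ?_
      have : NeZero d := ⟨hd.ne'⟩
      have h1 : μ {x} = 0 := hμ (measure_singleton x)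
      simp only [hp, B, ← h, Metric.closedBall_zero, measureReal_def, h1, ENNReal.toReal_zero]
    have hcdf := cdf_localLaw (ν := ν) hg hB hpos θ
    rw [← hp] at hcdf
    change p * cdf (localLaw g μ ν B) θ = J.real E at hcdf
    rw [← hcdf]
    have hbias := hA1 x hx r hr0 θ
    change |cdf (localLaw g μ ν B) θ - _| ≤ _ at hbias
    set FB := cdf (localLaw g μ ν B) θ
    set F := cdf (codeLaw g ν x) θ
    have hmul : -(σ * (M x * r)) ≤ (θ - q) * (FB - F) := by
      refine neg_le_of_abs_le ?_
      rw [abs_mul]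
      gcongr
      exact (abs_nonneg _).trans hσ
    have hkey : c * (θ - q) ^ 2 - σ * (M x * r) ≤ (θ - q) * (FB - α) := by nlinarith
    have := mul_le_mul_of_nonneg_left hkey (by positivity : 0 ≤ 2 * s * p)
    nlinarith

end Step

/-! ### The recursion for the mean squared error -/

section Recursion

variable {d m : ℕ} {g : EuclideanSpace ℝ (Fin d) → EuclideanSpace ℝ (Fin m) → ℝ}
  {μ : Measure (EuclideanSpace ℝ (Fin d))}
  {ν : Measure (EuclideanSpace ℝ (Fin m))}
  {Ω : Type*} [MeasurableSpace Ω] {P : Measure Ω}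
  {X : ℕ → Ω → EuclideanSpace ℝ (Fin d)} {Y : ℕ → Ω → ℝ}
  {x : EuclideanSpace ℝ (Fin d)} {k n : ℕ}

theorem integrable_kthMass_pow [IsProbabilityMeasure μ] [IsProbabilityMeasure P]
    (hX : ∀ i, Measurable (X i)) (hk : 1 ≤ k) (j : ℕ) :
    Integrable (fun ω => (kthMass μ x k n (fun i => X i ω)).toReal ^ j) P := by
  have hm : Measurable (fun ω => (kthMass μ x k n (fun i => X i ω)).toReal ^ j) :=
    (((measurable_kthMass hk).comp (measurable_pi_lambda _ hX)).ennreal_toReal).pow_const j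
  refine Integrable.of_bound hm.aestronglyMeasurable 1 (Filter.Eventually.of_forall fun ω => ?_)
  rw [Real.norm_of_nonneg (by positivity)]
  exact pow_le_one₀ ENNReal.toReal_nonneg
    (ENNReal.toReal_mono ENNReal.one_ne_top (kthMass_le_one _))

theorem ofReal_integral_kthMass_pow [IsProbabilityMeasure μ] [IsProbabilityMeasure P]
    (hX : ∀ i, Measurable (X i)) (hk : 1 ≤ k) (j : ℕ) :
    ENNReal.ofReal (∫ ω, (kthMass μ x k n (fun i => X i ω)).toReal ^ j ∂P) =
      ∫⁻ ω, kthMass μ x k n (fun i => X i ω) ^ j ∂P := by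
  rw [ofReal_integral_eq_lintegral_ofReal (integrable_kthMass_pow hX hk j)
    (Filter.Eventually.of_forall fun ω => by positivity)]
  refine lintegral_congr fun ω => ?_
  rw [ENNReal.ofReal_pow ENNReal.toReal_nonneg,
    ENNReal.ofReal_toReal ((kthMass_le_one _).trans_lt ENNReal.one_lt_top).ne]

theorem integral_kthMass_le [IsProbabilityMeasure μ] [IsProbabilityMeasure P]
    (hd : 0 < d) (hμ : μ ≪ volume) (hX : ∀ i, Measurable (X i))
    (hind : iIndepFun X P) (hlaw : ∀ i, P.map (X i) = μ) (hk : 1 ≤ k) :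
    ∫ ω, (kthMass μ x k n (fun i => X i ω)).toReal ∂P ≤ k / (n + 1 : ℕ) := by
  have h := lintegral_kthMass_le (x := x) (n := n) hd hμ hX hind hlaw hk
  have h1 := ofReal_integral_kthMass_pow (μ := μ) (P := P) (x := x) (n := n) hX hk 1
  simp only [pow_one] at h1
  rw [← h1] at h
  rw [le_div_iff₀ (by positivity), mul_comm, ← ENNReal.ofReal_le_ofReal_iff (by positivity),
    ENNReal.ofReal_mul (by positivity), ENNReal.ofReal_natCast, ENNReal.ofReal_natCast]
  exact_mod_cast h

theorem integral_kthMass_sq_le [IsProbabilityMeasure μ] [IsProbabilityMeasure P]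
    (hd : 0 < d) (hμ : μ ≪ volume) (hX : ∀ i, Measurable (X i))
    (hind : iIndepFun X P) (hlaw : ∀ i, P.map (X i) = μ) (hk : 1 ≤ k) :
    ∫ ω, (kthMass μ x k n (fun i => X i ω)).toReal ^ 2 ∂P ≤ 2 * (k / (n + 1 : ℕ)) ^ 2 := by
  have h := lintegral_kthMass_sq_le (x := x) (n := n) hd hμ hX hind hlaw hk
  rw [← ofReal_integral_kthMass_pow hX hk 2] at h
  set I := ∫ ω, (kthMass μ x k n (fun i => X i ω)).toReal ^ 2 ∂P with hI
  have hI0 : 0 ≤ I := integral_nonneg fun ω => by positivity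
  have h2 : ((n + 2 : ℕ) : ℝ) * (((n + 1 : ℕ) : ℝ) * I) ≤ ((k + 1 : ℕ) : ℝ) * k := by
    rw [← ENNReal.ofReal_le_ofReal_iff (by positivity), ENNReal.ofReal_mul (by positivity),
      ENNReal.ofReal_mul (by positivity), ENNReal.ofReal_mul (by positivity)]
    simp only [ENNReal.ofReal_natCast]
    exact_mod_cast h
  have hk' : (1 : ℝ) ≤ k := by exact_mod_cast hk
  have hn0 : (0 : ℝ) ≤ n := Nat.cast_nonneg n
  rw [div_pow, ← mul_div_assoc, le_div_iff₀ (by positivity)]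
  push_cast at h2 ⊢
  have h3 : 0 ≤ (n + 1 : ℝ) * I := by positivity
  nlinarith

/-- The mean of `p ^ (1 / d + 1)` for the mass `p`, interpolated between the first two moments. -/
theorem integral_interpolation_le [IsProbabilityMeasure μ] [IsProbabilityMeasure P]
    (hd : 0 < d) (hμ : μ ≪ volume) (hX : ∀ i, Measurable (X i))
    (hind : iIndepFun X P) (hlaw : ∀ i, P.map (X i) = μ) (hk : 1 ≤ k) {q : ℝ}
    (hq : q = k / (n + 1 : ℕ)) :
    ∫ ω, ((1 - 1 / (d : ℝ)) * ((kthMass μ x k n (fun i => X i ω)).toReal / q) +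
      1 / (d : ℝ) * ((kthMass μ x k n (fun i => X i ω)).toReal / q) ^ 2) ∂P ≤ 1 + 1 / (d : ℝ) := by
  have hq0 : 0 < q := by
    rw [hq]
    have : (1 : ℝ) ≤ k := by exact_mod_cast hk
    positivity
  have hd' : (1 : ℝ) ≤ d := by exact_mod_cast hd
  have h0 : 0 ≤ 1 / (d : ℝ) := by positivity
  have h1 : 1 / (d : ℝ) ≤ 1 := by
    rw [div_le_one (by linarith)]
    exact hd'
  have e1 := integral_kthMass_le (x := x) (n := n) hd hμ hX hind hlaw hk
  have e2 := integral_kthMass_sq_le (x := x) (n := n) hd hμ hX hind hlaw hk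
  rw [← hq] at e1 e2
  have i1 := integrable_kthMass_pow (μ := μ) (P := P) (x := x) (n := n) hX hk 1
  have i2 := integrable_kthMass_pow (μ := μ) (P := P) (x := x) (n := n) hX hk 2
  simp only [pow_one] at i1
  simp only [div_pow]
  rw [integral_add ((i1.div_const q).const_mul _) ((i2.div_const (q ^ 2)).const_mul _),
    integral_const_mul, integral_const_mul, integral_div, integral_div]
  have f1 : (∫ ω, (kthMass μ x k n (fun i => X i ω)).toReal ∂P) / q ≤ 1 := by
    rwa [div_le_one hq0]
  have f2 : (∫ ω, (kthMass μ x k n (fun i => X i ω)).toReal ^ 2 ∂P) / q ^ 2 ≤ 2 := by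
    rwa [div_le_iff₀ (by positivity)]
  nlinarith [mul_le_mul_of_nonneg_left f1 (sub_nonneg.2 h1), mul_le_mul_of_nonneg_left f2 h0]

/-- From rank `N0` on, the mass of the neighbours' ball falls below `N ^ (-ε)` only with
exponentially small probability. -/
theorem two_mul_mul_measureReal_kthMass_lt_le [IsProbabilityMeasure μ]
    (hX : ∀ i, Measurable (X i)) (hind : iIndepFun X P)
    (hlaw : ∀ i, P.map (X i) = μ) {β ε : ℝ} (hβ0 : 0 < β) (hβ : β < 1) (hε : 1 - β < ε)
    (hε1 : ε < 1) (hn : N0 ε β + 1 ≤ n + 1) :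
    ((n + 1 : ℕ) : ℝ) ^ (-ε) ≤ 1 / 2 ∧
    2 * ((n + 1 : ℕ) : ℝ) ^ (-ε) * P.real {ω | kthMass μ x (numNeighbours β (n + 1)) n
      (fun i => X i ω) < ENNReal.ofReal (((n + 1 : ℕ) : ℝ) ^ (-ε))} ≤
      Real.exp (-(3 * ((n + 1 : ℕ) : ℝ) ^ (1 - ε) / 8)) := by
  have h4 : 4 ≤ n + 1 := four_le_of_N0_lt hβ hε hε1 hn
  set N := n + 1 with hNdef
  have hN0 : (0 : ℝ) < (N : ℝ) := by positivity
  have hN1 : (1 : ℝ) ≤ (N : ℝ) := by exact_mod_cast (by omega : 1 ≤ N)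
  have hk := one_le_numNeighbours hβ0.le (by omega : 1 ≤ N)
  have hkn : numNeighbours β N ≤ n := by
    have := numNeighbours_lt hβ (by omega : 2 ≤ N)
    omega
  set p : ℝ := (N : ℝ) ^ (-ε) with hp
  have hp0 : 0 < p := by positivity
  have hNp : (N : ℝ) ^ (1 - ε) = N * p := by
    rw [hp, sub_eq_add_neg, Real.rpow_add hN0, Real.rpow_one]
  have h2 := two_mul_rpow_le_of_N0_le hε (by omega : 0 < N) (by omega : N0 ε β ≤ N)
  rw [hNp] at h2
  have hp2 : p ≤ 1 / 2 := by
    have : (N : ℝ) ^ β ≤ N := by simpa using Real.rpow_le_rpow_of_exponent_le hN1 hβ.le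
    nlinarith
  refine ⟨hp2, ?_⟩
  have hfloor : 2 * (N * p) - 1 ≤ (numNeighbours β N : ℝ) := by
    have := Nat.lt_floor_add_one ((N : ℝ) ^ β)
    unfold numNeighbours
    linarith
  have hnum := two_mul_mul_one_add_pow_le h4 hp0.le hp2 hfloor
  have hch := measure_kthMass_lt_le (x := x) hX hind hlaw hk hkn (ENNReal.ofReal p)
  set A := {ω | kthMass μ x (numNeighbours β N) n (fun i => X i ω) < ENNReal.ofReal p}
  have hch' : 2 ^ numNeighbours β N * P.real A ≤ (1 + p) ^ n := by
    have := ENNReal.toReal_mono (by finiteness) hch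
    rwa [ENNReal.toReal_mul, ENNReal.toReal_pow, ENNReal.toReal_pow, ENNReal.toReal_add
      ENNReal.one_ne_top ENNReal.ofReal_ne_top, ENNReal.toReal_ofReal hp0.le, ENNReal.toReal_one,
      ENNReal.toReal_ofNat] at this
  rw [hNp]
  have h2k : (0 : ℝ) < 2 ^ numNeighbours β N := by positivity
  refine le_of_mul_le_mul_left ?_ h2k
  calc 2 ^ numNeighbours β N * (2 * p * P.real A)
      = 2 * p * (2 ^ numNeighbours β N * P.real A) := by ring
    _ ≤ 2 * p * (1 + p) ^ n := by gcongr
    _ ≤ _ := by simpa [hNdef] using hnum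

theorem abs_sub_le_sqrtC1 {α LY UY θ q : ℝ} (hα : 1 / 2 ≤ α)
    (hθ : θ ∈ Icc (LY - (1 - α)) (UY + α)) (hq : q ∈ Icc LY UY) : |θ - q| ≤ sqrtC1 LY UY α := by
  unfold sqrtC1
  rw [abs_le]
  constructor <;> linarith [hθ.1, hθ.2, hq.1, hq.2]

/-- Properties of the sample that hold almost surely for all ranks. -/
theorem ae_sample_mem [IsProbabilityMeasure ν] (hg : Measurable (Function.uncurry g)) {LY UY : ℝ}
    (hA3 : AssumptionA3 g LY UY) (hX : ∀ i, Measurable (X i)) (hY : ∀ i, Measurable (Y i))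
    (hlaw : ∀ i, P.map (fun ω => (X i ω, Y i ω)) = jointLaw g μ ν) :
    ∀ᵐ ω ∂P, ∀ i, X i ω ∈ μ.support ∧ Y i ω ∈ Icc LY UY := by
  rw [ae_all_iff]
  intro i
  have hJ : ∀ᵐ z ∂(jointLaw g μ ν), z.1 ∈ μ.support ∧ z.2 ∈ Icc LY UY := by
    have h1 : ∀ᵐ z ∂(jointLaw g μ ν), z.1 ∈ μ.support := by
      have : ∀ᵐ u ∂((jointLaw g μ ν).map Prod.fst), u ∈ μ.support := by
        rw [map_fst_jointLaw hg]
        exact Measure.support_mem_ae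
      exact ae_of_ae_map measurable_fst.aemeasurable this
    have h2 : ∀ᵐ z ∂(jointLaw g μ ν), z.2 ∈ Icc LY UY := by
      rw [jointLaw, ae_map_iff (measurable_pair_code hg).aemeasurable
        (measurable_snd measurableSet_Icc)]
      exact Filter.Eventually.of_forall fun p => hA3 p.1 p.2
    exact h1.and h2
  rw [← hlaw i] at hJ
  exact ae_of_ae_map ((hX i).prodMk (hY i)).aemeasurable hJ

theorem codeLaw_compl_Icc (hg : Measurable (Function.uncurry g)) {LY UY : ℝ}
    (hA3 : AssumptionA3 g LY UY) (x : EuclideanSpace ℝ (Fin d)) :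
    codeLaw g ν x (Icc LY UY)ᶜ = 0 := by
  have hgx : Measurable (g x) := hg.comp measurable_prodMk_left
  rw [codeLaw, Measure.map_apply hgx measurableSet_Icc.compl]
  convert measure_empty (μ := ν)
  ext e
  simpa using hA3 x e

/-- The error stays bounded almost surely, so its square is integrable. -/
theorem integrable_theta_sub_sq [IsProbabilityMeasure P]
    (hX : ∀ i, Measurable (X i)) (hY : ∀ i, Measurable (Y i))
    {α γ β θ₀ q s : ℝ} (hβ : 0 ≤ β)
    (hbdd : ∀ᵐ ω ∂P, ∀ j, |theta α γ β θ₀ x (fun i => X i ω) (fun i => Y i ω) j - q| ≤ s) (j : ℕ) :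
    Integrable (fun ω => (theta α γ β θ₀ x (fun i => X i ω) (fun i => Y i ω) j - q) ^ 2) P := by
  have hm : Measurable (fun ω => theta α γ β θ₀ x (fun i => X i ω) (fun i => Y i ω) j) :=
    (measurable_theta hβ j).comp (measurable_pi_lambda _ fun i => (hX i).prodMk (hY i))
  refine Integrable.of_bound ((hm.sub_const q).pow_const 2).aestronglyMeasurable (s ^ 2) ?_
  filter_upwards [hbdd] with ω hω
  rw [Real.norm_of_nonneg (sq_nonneg _)]
  exact sq_le_sq.2 ((hω j).trans (le_abs_self s))

theorem sq_sub_mul_sq_le {T p p₀ c s : ℝ} (hc : 0 ≤ c) (hs : 0 ≤ s) (hp : p₀ ≤ p) :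
    T ^ 2 - 2 * c * s * p * T ^ 2 ≤ (1 - 2 * c * (s * p₀)) * T ^ 2 := by
  have := mul_le_mul_of_nonneg_left hp (by positivity : 0 ≤ 2 * c * s * T ^ 2)
  linarith

theorem sq_sub_mul_sq_le_add {T p p₀ c s σ : ℝ} (hc : 0 ≤ c) (hs : 0 ≤ s) (hp₀ : 0 ≤ p₀)
    (hp : 0 ≤ p) (hT : T ^ 2 ≤ σ ^ 2) :
    T ^ 2 - 2 * c * s * p * T ^ 2 ≤
      (1 - 2 * c * (s * p₀)) * T ^ 2 + 2 * c * s * p₀ * σ ^ 2 := by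
  have h1 := mul_le_mul_of_nonneg_left hT (by positivity : 0 ≤ 2 * c * s * p₀)
  have h2 : 0 ≤ 2 * c * s * p * T ^ 2 := by positivity
  linarith

theorem rpow_mul_le_C3 (hd : 0 < d) {c : ℝ} (hc : 0 < c) :
    (1 / (c * C4 d)) ^ (1 / (d : ℝ)) * (1 + 1 / (d : ℝ)) ≤ C3 c d := by
  have hd' : (0 : ℝ) < d := by exact_mod_cast hd
  have hC4 := C4_pos d
  have h : 1 / (d : ℝ) ≤ 8 / (3 * (d : ℝ)) := by
    rw [div_le_div_iff₀ hd' (by positivity)]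
    linarith
  unfold C3
  gcongr
  norm_num

/-- The mean squared error contracts at each step by the factor `1 - 2 C₂ γ_N N ^ (-ε)`, up to the
remainder: the contraction uses the mass of the neighbours' ball only where this mass is at least
`N ^ (-ε)`. -/
theorem integral_theta_succ_le [IsProbabilityMeasure ν] [IsProbabilityMeasure μ] [IsProbabilityMeasure P]
    (hd : 0 < d) (hg : Measurable (Function.uncurry g))
    {M Cg : EuclideanSpace ℝ (Fin d) → ℝ} {Cinput LY UY : ℝ}
    (hA1 : AssumptionA1 g μ ν M) (hA2 : AssumptionA2 μ Cinput) (hA4 : AssumptionA4 g μ ν Cg)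
    (hX : ∀ i, Measurable (X i)) (hY : ∀ i, Measurable (Y i))
    (hindep : iIndepFun (fun i ω => (X i ω, Y i ω)) P)
    (hlaw : ∀ i, P.map (fun ω => (X i ω, Y i ω)) = jointLaw g μ ν)
    {α : ℝ} (hα : α ∈ Ico (1 / 2 : ℝ) 1) (hx : x ∈ μ.support)
    {ρ : ℝ} (hρ : 0 < ρ) (hfill : FillsBalls μ.support x ρ) (hLU : LY ≤ UY) {θ₀ γ β ε : ℝ}
    (hγ : 0 < γ) (hβ0 : 0 < β) (hβ : β < 1) (hε : 1 - β < ε) (hε1 : ε < 1)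
    (hbdd : ∀ᵐ ω ∂P, ∀ j, |theta α γ β θ₀ x (fun i => X i ω) (fun i => Y i ω) j -
      quantile (codeLaw g ν x) α| ≤ sqrtC1 LY UY α)
    (hsupp : ∀ᵐ ω ∂P, ∀ i, X i ω ∈ μ.support) (hn : N0 ε β ≤ n) :
    ∫ ω, (theta α γ β θ₀ x (fun i => X i ω) (fun i => Y i ω) (n + 1) -
        quantile (codeLaw g ν x) α) ^ 2 ∂P ≤
      (1 - 2 * C2 (Cg x) LY UY α * ((n + 1 : ℕ) : ℝ) ^ (-ε - γ)) *
        ∫ ω, (theta α γ β θ₀ x (fun i => X i ω) (fun i => Y i ω) n -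
          quantile (codeLaw g ν x) α) ^ 2 ∂P +
      remainder (sqrtC1 LY UY α) (M x) (C3 (ρ * Cinput) d) γ β ε d (n + 1) := by
  classical
  have hα01 : α ∈ Icc (0 : ℝ) 1 := ⟨by linarith [hα.1], hα.2.le⟩
  have hμ : μ ≪ volume := by
    obtain ⟨-, f, -, hf, -⟩ := hA2
    rw [hf]
    exact withDensity_absolutelyContinuous _ _
  have hL := isProbabilityMeasure_codeLaw (ν := ν) hg x
  obtain ⟨hCg, hconn, f, -, hf, hfc⟩ := hA4 x hx
  set q := quantile (codeLaw g ν x) α with hq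
  set σ := sqrtC1 LY UY α with hσ
  set c := C2 (Cg x) LY UY α with hc
  have hc0 : 0 ≤ c := C2_nonneg hCg.le hLU hα
  have hc1 : c ≤ 1 := C2_le_one hLU hα
  have hσ0 : 0 ≤ σ := by
    rw [hσ, sqrtC1]
    linarith [hα.1]
  have hM : 0 ≤ M x := by simpa using (abs_nonneg _).trans (hA1 x hx 1 one_pos 0)
  have hZ : ∀ i, Measurable (fun ω => (X i ω, Y i ω)) := fun i => (hX i).prodMk (hY i)
  have hXind : iIndepFun X P := hindep.comp (fun _ => Prod.fst) fun _ => measurable_fst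
  have hXlaw : ∀ i, P.map (X i) = μ := by
    intro i
    rw [← map_fst_jointLaw (μ := μ) (ν := ν) hg, ← hlaw i, Measure.map_map measurable_fst (hZ i)]
    rfl
  set N := n + 1 with hN
  set k := numNeighbours β N with hkdef
  set s := stepSize γ N with hs
  obtain ⟨hs0, hs1⟩ : s ∈ Icc (0 : ℝ) 1 := stepSize_mem_Icc hγ N
  have h4 : 4 ≤ N := four_le_of_N0_lt hβ hε hε1 (by omega)
  have hk : 1 ≤ k := one_le_numNeighbours hβ0.le (by omega)
  have hkn : k ≤ n := by
    have := numNeighbours_lt hβ (by omega : 2 ≤ N)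
    omega
  obtain ⟨-, htail⟩ := two_mul_mul_measureReal_kthMass_lt_le (x := x) (n := n) hX hXind hXlaw hβ0
    hβ hε hε1 (by omega)
  rw [← hN, ← hkdef] at htail
  set p₀ : ℝ := (N : ℝ) ^ (-ε) with hp₀
  have hp₀0 : 0 ≤ p₀ := by positivity
  have hsp : (N : ℝ) ^ (-ε - γ) = s * p₀ := by
    rw [hs, stepSize, hp₀, ← Real.rpow_add (by positivity)]
    congr 1
    ring
  set K : ℝ := (1 / (ρ * Cinput * C4 d)) ^ (1 / (d : ℝ)) with hK
  have hpos : 0 < ρ * Cinput * C4 d := mul_pos (mul_pos hρ hA2.1) (C4_pos d)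
  have hK0 : 0 ≤ K := by positivity
  set Q : ℝ := (k : ℝ) / N with hQ
  have hQ0 : 0 < Q := by
    have : (1 : ℝ) ≤ k := by exact_mod_cast hk
    positivity
  let T : Ω → ℝ := fun ω => theta α γ β θ₀ x (fun i => X i ω) (fun i => Y i ω) n - q
  let p : Ω → ℝ := fun ω => (kthMass μ x k n (fun i => X i ω)).toReal
  set A : Set Ω := {ω | kthMass μ x k n (fun i => X i ω) < ENNReal.ofReal p₀} with hA
  have hAm : MeasurableSet A :=
    measurableSet_lt ((measurable_kthMass hk).comp (measurable_pi_lambda _ hX)) measurable_const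
  let R : Ω → ℝ := fun ω => (1 - 1 / (d : ℝ)) * (p ω / Q) + 1 / (d : ℝ) * (p ω / Q) ^ 2
  -- the squared error after one step, as a function of the past and of the new observation
  let F : (ℕ → EuclideanSpace ℝ (Fin d) × ℝ) → EuclideanSpace ℝ (Fin d) × ℝ → ℝ := fun w z =>
    (theta α γ β θ₀ x (fun i => (w i).1) (fun i => (w i).2) n -
      s * ((if z.2 ≤ theta α γ β θ₀ x (fun i => (w i).1) (fun i => (w i).2) n then 1 else 0) - α) *
        (if edist z.1 x ≤ kthDistance (fun i => (w i).1) x k n then 1 else 0) - q) ^ 2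
  have hFm : Measurable (Function.uncurry F) := by
    have h1 : Measurable (fun y : (ℕ → EuclideanSpace ℝ (Fin d) × ℝ) ×
        (EuclideanSpace ℝ (Fin d) × ℝ) =>
        theta α γ β θ₀ x (fun i => (y.1 i).1) (fun i => (y.1 i).2) n) :=
      (measurable_theta hβ0.le n).comp measurable_fst
    have h2 : Measurable (fun y : (ℕ → EuclideanSpace ℝ (Fin d) × ℝ) ×
        (EuclideanSpace ℝ (Fin d) × ℝ) => kthDistance (fun i => (y.1 i).1) x k n) :=
      (measurable_kthDistance hk).comp (measurable_pi_lambda _ fun i => by fun_prop)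
    exact (((h1.sub ((measurable_const.mul ((Measurable.ite (measurableSet_le (by fun_prop) h1)
      measurable_const measurable_const).sub measurable_const)).mul
      (Measurable.ite (measurableSet_le (by fun_prop) h2) measurable_const
        measurable_const))).sub measurable_const)).pow_const 2
  have hFloc : ∀ w w', (∀ i < n, w i = w' i) → F w = F w' := by
    intro w w' h
    funext z
    simp only [F]
    rw [theta_congr (u := fun i => (w i).1) (u' := fun i => (w' i).1) (y := fun i => (w i).2)
      (y' := fun i => (w' i).2) (fun i hi => by rw [h i hi]) (fun i hi => by rw [h i hi]),
      kthDistance_congr (u := fun i => (w i).1) (v := fun i => (w' i).1)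
        (fun i hi => by rw [h i hi])]
  have hstep : ∀ ω, (theta α γ β θ₀ x (fun i => X i ω) (fun i => Y i ω) N - q) ^ 2 =
      F (fun i => (X i ω, Y i ω)) (X n ω, Y n ω) := by
    intro ω
    simp only [hN, theta, F, hs, hkdef]
  have hint : ∀ j, Integrable
      (fun ω => (theta α γ β θ₀ x (fun i => X i ω) (fun i => Y i ω) j - q) ^ 2) P :=
    integrable_theta_sub_sq hX hY hβ0.le hbdd
  obtain ⟨hIint, hIeq⟩ := integral_past hZ hindep hFm hFloc
    ((hint N).congr (Filter.Eventually.of_forall hstep))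
  rw [integral_congr_ae (Filter.Eventually.of_forall hstep), hIeq]
  rw [hlaw] at hIint ⊢
  -- the terms of the bound
  have i1 : Integrable (fun ω => T ω ^ 2) P := hint n
  have i2 : Integrable (A.indicator (1 : Ω → ℝ)) P := (integrable_const 1).indicator hAm
  have i3 : Integrable p P := by
    simpa using integrable_kthMass_pow (μ := μ) (P := P) (x := x) (n := n) hX hk 1
  have i4 : Integrable R P := by
    have i5 := integrable_kthMass_pow (μ := μ) (P := P) (x := x) (n := n) hX hk 2
    simp only [R, div_pow]
    exact ((i3.div_const Q).const_mul _).add ((i5.div_const (Q ^ 2)).const_mul _)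
  set a₁ := 1 - 2 * c * (s * p₀) with ha₁
  set a₂ := 2 * c * s * p₀ * σ ^ 2 with ha₂
  set a₃ := 2 * s * σ * M x * (K * Q ^ (1 / (d : ℝ) + 1)) with ha₃
  have ha₂0 : 0 ≤ a₂ := by positivity
  have ha₃0 : 0 ≤ a₃ := by positivity
  have hbound : ∀ᵐ ω ∂P, ∫ z, F (fun i => (X i ω, Y i ω)) z ∂(jointLaw g μ ν) ≤
      a₁ * T ω ^ 2 + a₂ * A.indicator (1 : Ω → ℝ) ω + a₃ * R ω + s ^ 2 * p ω := by
    filter_upwards [hbdd, hsupp] with ω hω hω'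
    obtain ⟨r, hr0, hiff, hmass, hr⟩ :=
      exists_kthDistance_eq_ofReal hd hA2 hρ hfill hω' hk hkn
    have hT : |T ω| ≤ σ := hω n
    have hTσ : T ω ^ 2 ≤ σ ^ 2 := sq_le_sq.2 (hT.trans (le_abs_self σ))
    have hp0 : 0 ≤ p ω := ENNReal.toReal_nonneg
    have hone := integral_step_sq_le (s := s) (c := c) hd hg hμ hA1 hx hα01 hs0 hr0 hT
      (C2_mul_sq_le hf hfc hCg.le hconn hα hLU hT)
    rw [← hmass] at hone
    have hFe : ∫ z, F (fun i => (X i ω, Y i ω)) z ∂(jointLaw g μ ν) =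
        ∫ z, (theta α γ β θ₀ x (fun i => X i ω) (fun i => Y i ω) n - s * ((if z.2 ≤
          theta α γ β θ₀ x (fun i => X i ω) (fun i => Y i ω) n then 1 else 0) - α) *
          (if z.1 ∈ Metric.closedBall x r then 1 else 0) - q) ^ 2 ∂(jointLaw g μ ν) := by
      refine integral_congr_ae (Filter.Eventually.of_forall fun z => ?_)
      simp only [F, hiff]
    rw [hFe]
    refine hone.trans ?_
    change T ω ^ 2 - 2 * c * s * p ω * T ω ^ 2 + 2 * s * σ * M x * (r * p ω) + s ^ 2 * p ω ≤ _
    have hrp : r * p ω ≤ K * Q ^ (1 / (d : ℝ) + 1) * R ω := by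
      calc r * p ω ≤ K * p ω ^ (1 / (d : ℝ)) * p ω := by gcongr
        _ = K * p ω ^ (1 / (d : ℝ) + 1) := by
            rw [Real.rpow_add_one' hp0 (by positivity), mul_assoc]
        _ ≤ K * (Q ^ (1 / (d : ℝ) + 1) * R ω) := by
            gcongr
            exact rpow_one_div_add_one_le hd hp0 hQ0
        _ = _ := by ring
    have hbias : 2 * s * σ * M x * (r * p ω) ≤ a₃ * R ω := by
      rw [ha₃, mul_assoc (2 * s * σ * M x)]
      gcongr
    have hcontr : T ω ^ 2 - 2 * c * s * p ω * T ω ^ 2 ≤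
        a₁ * T ω ^ 2 + a₂ * A.indicator (1 : Ω → ℝ) ω := by
      by_cases hωA : ω ∈ A
      · rw [indicator_of_mem hωA, Pi.one_apply, mul_one]
        exact sq_sub_mul_sq_le_add hc0 hs0 hp₀0 hp0 hTσ
      · rw [indicator_of_notMem hωA, mul_zero, add_zero]
        refine sq_sub_mul_sq_le hc0 hs0 ?_
        rw [hA, mem_ofPred_eq, not_lt] at hωA
        exact (ENNReal.ofReal_le_iff_le_toReal
          ((kthMass_le_one _).trans_lt ENNReal.one_lt_top).ne).1 hωA
    linarith
  have j1 := i1.const_mul a₁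
  have j2 := i2.const_mul a₂
  have j3 := i4.const_mul a₃
  have j4 := i3.const_mul (s ^ 2)
  have j12 : Integrable (fun ω => a₁ * T ω ^ 2 + a₂ * A.indicator (1 : Ω → ℝ) ω) P := j1.add j2
  have j123 : Integrable
      (fun ω => a₁ * T ω ^ 2 + a₂ * A.indicator (1 : Ω → ℝ) ω + a₃ * R ω) P := j12.add j3
  have hsum : ∫ ω, (a₁ * T ω ^ 2 + a₂ * A.indicator (1 : Ω → ℝ) ω + a₃ * R ω + s ^ 2 * p ω) ∂P =
      a₁ * ∫ ω, T ω ^ 2 ∂P + a₂ * P.real A + a₃ * ∫ ω, R ω ∂P + s ^ 2 * ∫ ω, p ω ∂P := by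
    rw [integral_add j123 j4, integral_add j12 j3, integral_add j1 j2,
      integral_const_mul, integral_const_mul, integral_const_mul, integral_const_mul,
      integral_indicator_one hAm]
  refine (integral_mono_ae hIint (j123.add j4) hbound).trans ?_
  change ∫ ω, (a₁ * T ω ^ 2 + a₂ * A.indicator (1 : Ω → ℝ) ω + a₃ * R ω + s ^ 2 * p ω) ∂P ≤ _
  rw [hsum, hsp]
  have b2 : a₂ * P.real A ≤ σ ^ 2 * Real.exp (-(3 * (N : ℝ) ^ (1 - ε) / 8)) := by
    have hcs : c * s ≤ 1 := mul_le_one₀ hc1 hs0 hs1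
    calc a₂ * P.real A = (c * s) * (σ ^ 2 * (2 * p₀ * P.real A)) := by rw [ha₂]; ring
      _ ≤ 1 * (σ ^ 2 * (2 * p₀ * P.real A)) := by gcongr
      _ ≤ _ := by
          rw [one_mul]
          gcongr
  have b3 : a₃ * ∫ ω, R ω ∂P ≤
      2 * σ * M x * C3 (ρ * Cinput) d * s * Q ^ (1 / (d : ℝ) + 1) := by
    have hR : ∫ ω, R ω ∂P ≤ 1 + 1 / (d : ℝ) :=
      integral_interpolation_le hd hμ hX hXind hXlaw hk hQ
    have hC3 := rpow_mul_le_C3 hd (mul_pos hρ hA2.1)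
    rw [← hK] at hC3
    calc a₃ * ∫ ω, R ω ∂P ≤ a₃ * (1 + 1 / (d : ℝ)) := by gcongr
      _ = 2 * σ * M x * (K * (1 + 1 / (d : ℝ))) * s * Q ^ (1 / (d : ℝ) + 1) := by rw [ha₃]; ring
      _ ≤ _ := by gcongr
  have b4 : s ^ 2 * ∫ ω, p ω ∂P ≤ s ^ 2 * Q := by
    gcongr
    exact integral_kthMass_le hd hμ hX hXind hXlaw hk
  rw [remainder, ← hs, ← hkdef, ← hQ]
  linarith

end Recursion

/-! ### The bound -/

theorem theorem2 {d m : ℕ} (hd : 0 < d)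
    -- the stochastic code, the law `μ` of the input and the law `ν` of the random seed
    (g : EuclideanSpace ℝ (Fin d) → EuclideanSpace ℝ (Fin m) → ℝ)
    (hg : Measurable (Function.uncurry g))
    (μ : Measure (EuclideanSpace ℝ (Fin d))) [IsProbabilityMeasure μ]
    (ν : Measure (EuclideanSpace ℝ (Fin m))) [IsProbabilityMeasure ν]
    (M Cg : EuclideanSpace ℝ (Fin d) → ℝ) (Cinput LY UY : ℝ)
    (hA1 : AssumptionA1 g μ ν M) (hA2 : AssumptionA2 μ Cinput)
    (hA3 : AssumptionA3 g LY UY) (hA4 : AssumptionA4 g μ ν Cg)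
    -- the i.i.d. sample of `(X, Y)`
    {Ω : Type*} [MeasurableSpace Ω] (P : Measure Ω) [IsProbabilityMeasure P]
    (X : ℕ → Ω → EuclideanSpace ℝ (Fin d)) (Y : ℕ → Ω → ℝ)
    (hX : ∀ i, Measurable (X i)) (hY : ∀ i, Measurable (Y i))
    (hindep : iIndepFun (fun i ω => (X i ω, Y i ω)) P)
    (hlaw : ∀ i, P.map (fun ω => (X i ω, Y i ω)) = jointLaw g μ ν)
    -- the level, the input of interest and the initial value
    (α : ℝ) (hα : α ∈ Ico (1 / 2 : ℝ) 1)
    (x : EuclideanSpace ℝ (Fin d)) (hx : x ∈ μ.support)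
    (ρ : ℝ) (hρ : 0 < ρ) (hfill : FillsBalls μ.support x ρ)
    (θ₀ : ℝ) (hθ₀ : θ₀ ∈ Icc (LY - (1 - α)) (UY + α))
    -- the parameters
    (γ β ε : ℝ) (hγ : 0 < γ) (hγβ : γ ≤ β) (hβ : β < 1) (hε : 1 - β < ε) (hε1 : ε < 1)
    (n : ℕ) (hn : N0 ε β + 1 ≤ n) :
    Integrable (fun ω => (theta α γ β θ₀ x (fun i => X i ω) (fun i => Y i ω) n
        - quantile (codeLaw g ν x) α) ^ 2) P ∧
    ∫ ω, (theta α γ β θ₀ x (fun i => X i ω) (fun i => Y i ω) n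
        - quantile (codeLaw g ν x) α) ^ 2 ∂P ≤
      Real.exp (-2 * C2 (Cg x) LY UY α * (kappa ε γ n - kappa ε γ (N0 ε β))) * C1 LY UY α +
      ∑ k ∈ Finset.Icc (N0 ε β + 1) n,
        Real.exp (-2 * C2 (Cg x) LY UY α * (kappa ε γ n - kappa ε γ k)) *
          remainder (sqrtC1 LY UY α) (M x) (C3 (ρ * Cinput) d) γ β ε d k +
      C1 LY UY α * Real.exp (-(3 * (n : ℝ) ^ (1 - ε) / 8)) := by
  have hβ0 : 0 < β := hγ.trans_le hγβ
  have hLU : LY ≤ UY := (hA3 0 0).1.trans (hA3 0 0).2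
  have hL := isProbabilityMeasure_codeLaw (ν := ν) hg x
  obtain ⟨hCg, -, f, -, hf, -⟩ := hA4 x hx
  have hLac : codeLaw g ν x ≪ volume := by
    rw [hf]
    exact withDensity_absolutelyContinuous _ _
  have hq := quantile_mem_Icc hLac ⟨by linarith [hα.1], hα.2⟩ (codeLaw_compl_Icc hg hA3 x)
  have hsample := ae_sample_mem (P := P) hg hA3 hX hY hlaw
  have hbdd : ∀ᵐ ω ∂P, ∀ j, |theta α γ β θ₀ x (fun i => X i ω) (fun i => Y i ω) j -
      quantile (codeLaw g ν x) α| ≤ sqrtC1 LY UY α := by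
    filter_upwards [hsample] with ω hω j
    exact abs_sub_le_sqrtC1 hα.1 (theta_mem_Icc hγ ⟨by linarith [hα.1], hα.2.le⟩ hθ₀
      (fun i => (hω i).2) j) hq
  have hint := integrable_theta_sub_sq hX hY hβ0.le hbdd
  refine ⟨hint n, ?_⟩
  have hinit : ∫ ω, (theta α γ β θ₀ x (fun i => X i ω) (fun i => Y i ω) (N0 ε β) -
      quantile (codeLaw g ν x) α) ^ 2 ∂P ≤ C1 LY UY α := by
    have h := integral_mono_ae (hint (N0 ε β)) (integrable_const (C1 LY UY α)) (by
      filter_upwards [hbdd] with ω hω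
      exact sq_le_sq.2 ((hω _).trans (le_abs_self _)))
    simpa using h
  have hrec := le_of_recursion
    (a := fun j => ∫ ω, (theta α γ β θ₀ x (fun i => X i ω) (fun i => Y i ω) j -
      quantile (codeLaw g ν x) α) ^ 2 ∂P)
    (t := fun i => (i : ℝ) ^ (-ε - γ))
    (D := remainder (sqrtC1 LY UY α) (M x) (C3 (ρ * Cinput) d) γ β ε d)
    (fun j => integral_nonneg fun ω => sq_nonneg _) hinit
    (fun j hj => integral_theta_succ_le hd hg hA1 hA2 hA4 hX hY hindep hlaw hα hx hρ hfill hLU hγ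
      hβ0 hβ hε hε1 hbdd (hsample.mono fun ω hω i => (hω i).1) hj)
    (by omega : N0 ε β ≤ n)
  have hlast : 0 ≤ C1 LY UY α * Real.exp (-(3 * (n : ℝ) ^ (1 - ε) / 8)) :=
    mul_nonneg (sq_nonneg _) (Real.exp_pos _).le
  simp only [← neg_mul] at hrec
  exact hrec.trans (le_add_of_nonneg_right hlast)
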